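/- **Theorem 3.** Let $a\in\mathbb R$, $a\neq 0$, let $U\subset\mathbb R^2$ be a non-empty open set with coordinates $(x,y)$, and let $h,H:U\to\mathbb R$ be smooth positive functions with $$\Delta\ln H=(\ln H)_{xx}+(\ln H)_{yy}=2a^2h^2+4a^2H^2\quad\text{on }U .$$ Put $g_\Sigma=h^2(dx^2+dy^2)$, $\omega_\Sigma=h^2\,dx\wedge dy$, $l_2=\frac1{2a}(\ln H)_y$, $n_2=-\frac1{2a}(\ln H)_x$, $\alpha=-2a\coth az$, and let $M=U\times\{(z,t)\in\mathbb R^2: z<0\}$. On $M$ define the $1$-forms $$\theta_3=\sinh 2az\,dt-\bigl(-\sin 2at\,\cosh 2az\,H+\sinh 2az\,l_2\bigr)dx-\bigl(\cos 2at\,\cosh 2az\,H+\sinh 2az\,n_2\bigr)dy,$$ $$\theta_4=dz-\cos 2at\,H\,dx-\sin 2at\,H\,dy$$ and the symmetric tensor $g=(\sinh az)^2g_\Sigma+\theta_3\otimes\theta_3+\theta_4\otimes\theta_4$. Then $g$ is a Riemannian metric on $M$, and there are almost complex structures $\bar J$ and $J$ on $M$ such that: 1. $(M,g,\bar J)$ is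 a Kähler surface whose Kähler form $\bar\Omega(X,Y)=g(\bar JX,Y)$ is $\bar\Omega=(\sinh az)^2\omega_\Sigma+\theta_4\wedge\theta_3$. It is a QCH Kähler surface with respect to the $\bar J$-invariant plane field $\mathcal D=\mathrm{span}\{\partial_z,\partial_t\}$: the holomorphic curvature $g(R(X,\bar JX)\bar JX,X)$ of a unit vector $X\in T_pM$ depends only on $p$ and on the length of the orthogonal projection of $X$ on $\mathcal D_p$. 2. $(M,g,J)$ is Hermitian (that is, $J$ is $g$-orthogonal and integrable) with Kähler form $\Omega(X,Y)=g(JX,Y)$ equal to $\Omega=(\sinh az)^2\omega_\Sigma+\theta_3\wedge\theta_4$, and $J$ is opposite to $\bar J$: $\Omega$ is anti-self-dual for the orientation in which $\bar\Omega$ is self-dual. 3. The Ricci tensor $\rho$ of $(M,g)$ is $J$-invariant: $\rho(JX,JY)=\rho(X,Y)$. 4. $(M,g,J)$ is not locally conformally Kähler: it is not true that every point of $M$ has an open neighbourhood on which, for some smooth function $\sigma$, the metric $e^{\sigma}g$ is Kähler with respect to $J$. 5. The Lee form of $(M,g,J)$, i.e. the $1$-form $\theta$ with $d\Omega=2\theta\wedge\Omega$,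 is $\theta=-\alpha\,\theta_4$. -/

import Mathlib

open scoped ContDiff

noncomputable section

namespace KahlerSurface

/-- Coordinate four-space with coordinates `(x, y, z, t) = (p 0, p 1, p 2, p 3)`; every tangent
space of an open subset is identified with `R4` itself. -/
abbrev R4 : Type := Fin 4 → ℝ

/-- Fields of bilinear forms, of endomorphisms, of 1-forms and of `n`-forms. -/
abbrev BilinField : Type := R4 → R4 →L[ℝ] R4 →L[ℝ] ℝ
abbrev EndField : Type := R4 → R4 →L[ℝ] R4
abbrev OneForm : Type := R4 → R4 →L[ℝ] ℝ
abbrev DiffForm (n : ℕ) : Type := R4 → R4 [⋀^Fin n]→L[ℝ] ℝ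

/-! ### Exterior algebra -/

/-- A covector as an alternating form of degree one. -/
def ofCovector : (R4 →L[ℝ] ℝ) →L[ℝ] R4 [⋀^Fin 1]→L[ℝ] ℝ :=
  (ContinuousAlternatingMap.ofSubsingletonLIE (𝕜 := ℝ) (E := R4) (F := ℝ) (0 : Fin 1)).toContinuousLinearEquiv

/-- Wedge product of a covector with an `n`-form, in the normalization
`(θ ∧ η)(u, v) = θ u * η v - θ v * η u` (the one compatible with `extDeriv`). -/
def covWedge {n : ℕ} (θ : R4 →L[ℝ] ℝ) (ψ : R4 [⋀^Fin n]→L[ℝ] ℝ) : R4 [⋀^Fin (n + 1)]→L[ℝ] ℝ :=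
  ContinuousAlternatingMap.alternatizeUncurryFin (θ.smulRight ψ)

/-- Wedge product of two covectors. -/
def wedge (θ η : R4 →L[ℝ] ℝ) : R4 [⋀^Fin 2]→L[ℝ] ℝ := covWedge θ (ofCovector η)

theorem wedge_apply (θ η : R4 →L[ℝ] ℝ) (u v : R4) :
    wedge θ η ![u, v] = θ u * η v - θ v * η u := by
  simp [wedge, covWedge, ofCovector, ContinuousAlternatingMap.alternatizeUncurryFin_apply,
    Fin.sum_univ_two, Fin.removeNth, sub_eq_add_neg]

theorem covWedge_apply (θ : R4 →L[ℝ] ℝ) (ψ : R4 [⋀^Fin 2]→L[ℝ] ℝ) (u v w : R4) :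
    covWedge θ ψ ![u, v, w] = θ u * ψ ![v, w] - θ v * ψ ![u, w] + θ w * ψ ![u, v] := by
  have h0 : Fin.removeNth (0 : Fin 3) ![u, v, w] = ![v, w] := by
    ext i; fin_cases i <;> rfl
  have h1 : Fin.removeNth (1 : Fin 3) ![u, v, w] = ![u, w] := by
    ext i; fin_cases i <;> rfl
  have h2 : Fin.removeNth (2 : Fin 3) ![u, v, w] = ![u, v] := by
    ext i; fin_cases i <;> rfl
  simp [covWedge, ContinuousAlternatingMap.alternatizeUncurryFin_apply,
    Fin.sum_univ_three, h0, h1, h2, sub_eq_add_neg]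

/-! ### Hermitian and Kähler structures on an open set `M` -/

/-- `g` is a smooth Riemannian metric on `M`. -/
structure IsRiemannian (M : Set R4) (g : BilinField) : Prop where
  smooth : ContDiffOn ℝ ∞ g M
  symm : ∀ p ∈ M, ∀ u v, g p u v = g p v u
  pos : ∀ p ∈ M, ∀ u, u ≠ 0 → 0 < g p u u

/-- `(M, g, J)` is an almost Hermitian manifold. -/
structure IsAlmostHermitian (M : Set R4) (g : BilinField) (J : EndField) : Prop where
  riemannian : IsRiemannian M g
  smooth : ContDiffOn ℝ ∞ J M
  sq : ∀ p ∈ M, ∀ u, J p (J p u) = -u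
  orthogonal : ∀ p ∈ M, ∀ u v, g p (J p u) (J p v) = g p u v

/-- The Nijenhuis tensor `[JX, JY] - J[JX, Y] - J[X, JY] - [X, Y]`. -/
def nijenhuis (J : EndField) (X Y : R4 → R4) (p : R4) : R4 :=
  VectorField.lieBracket ℝ (fun q => J q (X q)) (fun q => J q (Y q)) p
    - J p (VectorField.lieBracket ℝ (fun q => J q (X q)) Y p)
    - J p (VectorField.lieBracket ℝ X (fun q => J q (Y q)) p)
    - VectorField.lieBracket ℝ X Y p

/-- `(M, g, J)` is a Hermitian manifold: almost Hermitian with vanishing Nijenhuis tensor. -/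
structure IsHermitian (M : Set R4) (g : BilinField) (J : EndField) : Prop where
  almost : IsAlmostHermitian M g J
  integrable : ∀ X Y : R4 → R4, ContDiffOn ℝ ∞ X M → ContDiffOn ℝ ∞ Y M →
    ∀ p ∈ M, nijenhuis J X Y p = 0

/-- The Kähler form `(u, v) ↦ g (J u) v`. It is written as the skew part of this bilinear form so
as to be defined for all `g` and `J`; see `kahlerForm_apply`. -/
def kahlerForm (g : BilinField) (J : EndField) : DiffForm 2 := fun p =>
  (1 / 2 : ℝ) • ContinuousAlternatingMap.alternatizeUncurryFin (ofCovector ∘L (g p ∘L J p))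

theorem kahlerForm_apply {M : Set R4} {g : BilinField} {J : EndField}
    (hJ : IsAlmostHermitian M g J) {p : R4} (hp : p ∈ M) (u v : R4) :
    kahlerForm g J p ![u, v] = g p (J p u) v := by
  have h1 : g p (J p v) u = -g p (J p u) v := by
    rw [← hJ.orthogonal p hp (J p v) u, hJ.sq p hp, map_neg, neg_apply,
      hJ.riemannian.symm p hp]
  simp [kahlerForm, ofCovector, ContinuousAlternatingMap.alternatizeUncurryFin_apply,
    Fin.sum_univ_two, Fin.removeNth, h1]
  ring

/-- `(M, g, J)` is a Kähler manifold: Hermitian with closed Kähler form. -/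
structure IsKahler (M : Set R4) (g : BilinField) (J : EndField) : Prop where
  hermitian : IsHermitian M g J
  closed : ∀ p ∈ M, extDeriv (kahlerForm g J) p = 0

/-- `(M, g, J)` is locally conformally Kähler: near each point some metric `e^σ g` is Kähler
with respect to `J`. -/
def IsLocallyConformallyKahler (M : Set R4) (g : BilinField) (J : EndField) : Prop :=
  ∀ p ∈ M, ∃ V : Set R4, IsOpen V ∧ p ∈ V ∧ V ⊆ M ∧
    ∃ σ : R4 → ℝ, ContDiffOn ℝ ∞ σ V ∧ IsKahler V (fun q => Real.exp (σ q) • g q) J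

/-- `θ` is the Lee form of `(M, g, J)`: `dΩ = 2 θ ∧ Ω` for the Kähler form `Ω`. -/
def IsLeeForm (M : Set R4) (g : BilinField) (J : EndField) (θ : OneForm) : Prop :=
  ∀ p ∈ M, extDeriv (kahlerForm g J) p = (2 : ℝ) • covWedge (θ p) (kahlerForm g J p)

/-! ### Self-duality -/

/-- `e` is an orthonormal basis for the scalar product `b`. -/
def IsOrthonormalBasis (b : R4 →L[ℝ] R4 →L[ℝ] ℝ) (e : Module.Basis (Fin 4) ℝ R4) : Prop :=
  ∀ i j, b (e i) (e j) = if i = j then 1 else 0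

/-- `*ψ = ψ` for the scalar product `b` and the orientation `o`. The Hodge star of a 2-form is
given by `(*ψ)(e₀, e₁) = ψ(e₂, e₃)` for oriented orthonormal bases. -/
def IsSelfDual (b : R4 →L[ℝ] R4 →L[ℝ] ℝ) (o : Orientation ℝ R4 (Fin 4))
    (ψ : R4 [⋀^Fin 2]→L[ℝ] ℝ) : Prop :=
  ∀ e : Module.Basis (Fin 4) ℝ R4, IsOrthonormalBasis b e → e.orientation = o →
    ψ ![e 2, e 3] = ψ ![e 0, e 1]

/-- `*ψ = -ψ` for the scalar product `b` and the orientation `o`. -/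
def IsAntiSelfDual (b : R4 →L[ℝ] R4 →L[ℝ] ℝ) (o : Orientation ℝ R4 (Fin 4))
    (ψ : R4 [⋀^Fin 2]→L[ℝ] ℝ) : Prop :=
  ∀ e : Module.Basis (Fin 4) ℝ R4, IsOrthonormalBasis b e → e.orientation = o →
    ψ ![e 2, e 3] = -ψ ![e 0, e 1]

/-- `J'` is an opposite Hermitian structure on `(M, g, J)`: it is Hermitian, and its Kähler form is
anti-self-dual for the orientation in which the Kähler form of `J` is self-dual. -/
def IsOppositeHermitian (M : Set R4) (g : BilinField) (J J' : EndField) : Prop :=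
  IsHermitian M g J' ∧ ∀ p ∈ M, ∃ o : Orientation ℝ R4 (Fin 4),
    IsSelfDual (g p) o (kahlerForm g J p) ∧ IsAntiSelfDual (g p) o (kahlerForm g J' p)

/-! ### Levi-Civita connection and curvature -/

/-- The Christoffel symbols as a bilinear map: `christoffel g p u v` is the vector with
`g (Γ(u, v)) w = (D_u g(v, w) + D_v g(u, w) - D_w g(u, v)) / 2`. -/
def christoffel (g : BilinField) (p u v : R4) : R4 :=
  (g p).inverse ((1 / 2 : ℝ) •
    (fderiv ℝ g p u v + fderiv ℝ g p v u - ((fderiv ℝ g p).flip u).flip v))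

/-- The Levi-Civita covariant derivative `∇_X Y`. -/
def covDeriv (g : BilinField) (X Y : R4 → R4) (p : R4) : R4 :=
  fderiv ℝ Y p (X p) + christoffel g p (X p) (Y p)

/-- `R(X, Y) Z = ∇_X ∇_Y Z - ∇_Y ∇_X Z - ∇_[X, Y] Z` for vector fields. -/
def curvatureField (g : BilinField) (X Y Z : R4 → R4) (p : R4) : R4 :=
  covDeriv g X (covDeriv g Y Z) p - covDeriv g Y (covDeriv g X Z) p
    - covDeriv g (VectorField.lieBracket ℝ X Y) Z p

/-- The curvature tensor at `p`; tangent vectors are extended to constant vector fields. -/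
def curvature (g : BilinField) (p u v w : R4) : R4 :=
  curvatureField g (fun _ => u) (fun _ => v) (fun _ => w) p

/-- The Ricci tensor `ρ(u, v) = trace (w ↦ R(w, u) v)`. -/
def ricci (g : BilinField) (p u v : R4) : ℝ :=
  ∑ i : Fin 4, curvature g p (Pi.single i 1) u v i

/-- The Ricci tensor of `g` is `J`-invariant on `M`. -/
def HasInvariantRicci (M : Set R4) (g : BilinField) (J : EndField) : Prop :=
  ∀ p ∈ M, ∀ u v, ricci g p (J p u) (J p v) = ricci g p u v

/-! ### QCH structures -/

/-- `D` is a smooth distribution of rank two on `M`. -/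
def IsSmoothPlaneField (M : Set R4) (D : R4 → Submodule ℝ R4) : Prop :=
  (∀ p ∈ M, Module.finrank ℝ (D p) = 2) ∧
  ∀ p ∈ M, ∃ V : Set R4, IsOpen V ∧ p ∈ V ∧ V ⊆ M ∧ ∃ X Y : R4 → R4,
    ContDiffOn ℝ ∞ X V ∧ ContDiffOn ℝ ∞ Y V ∧ ∀ q ∈ V, D q = Submodule.span ℝ {X q, Y q}

/-- `(M, g, J)` is a QCH Kähler surface with respect to the plane field `D`: `D` is smooth and
`J`-invariant, and the holomorphic curvature `g(R(X, JX)JX, X)` of a unit vector `X` at `p`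
depends only on `p` and on the length of the `g`-orthogonal projection `X_D` of `X` on `D p`. -/
structure IsQCHKahler (M : Set R4) (g : BilinField) (J : EndField)
    (D : R4 → Submodule ℝ R4) : Prop where
  kahler : IsKahler M g J
  smooth : IsSmoothPlaneField M D
  invariant : ∀ p ∈ M, ∀ u ∈ D p, J p u ∈ D p
  holomorphicCurvature : ∃ φ : R4 → ℝ → ℝ, ∀ p ∈ M, ∀ X XD : R4, g p X X = 1 →
    XD ∈ D p → (∀ w ∈ D p, g p (X - XD) w = 0) →
    g p (curvature g p X (J p X) (J p X)) X = φ p (Real.sqrt (g p XD XD))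

/-! ### The explicit construction -/

/-- Partial derivatives of functions on the `(x, y)`-plane. -/
def partialX (f : ℝ × ℝ → ℝ) (q : ℝ × ℝ) : ℝ := fderiv ℝ f q (1, 0)
def partialY (f : ℝ × ℝ → ℝ) (q : ℝ × ℝ) : ℝ := fderiv ℝ f q (0, 1)

/-- `f_xx + f_yy`. -/
def flatLaplacian (f : ℝ × ℝ → ℝ) (q : ℝ × ℝ) : ℝ :=
  partialX (partialX f) q + partialY (partialY f) q

/-- `ln H`. -/
def lnFun (H : ℝ × ℝ → ℝ) (q : ℝ × ℝ) : ℝ := Real.log (H q)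

/-- `M = U × {(z, t) : z < 0}`. -/
def totalSpace (U : Set (ℝ × ℝ)) : Set R4 := {p | (p 0, p 1) ∈ U ∧ p 2 < 0}

/-- The coordinate differentials. -/
def dx : R4 →L[ℝ] ℝ := ContinuousLinearMap.proj 0
def dy : R4 →L[ℝ] ℝ := ContinuousLinearMap.proj 1
def dz : R4 →L[ℝ] ℝ := ContinuousLinearMap.proj 2
def dt : R4 →L[ℝ] ℝ := ContinuousLinearMap.proj 3

/-- `l₂ = (ln H)_y / (2a)` and `n₂ = -(ln H)_x / (2a)`. -/
def l₂ (a : ℝ) (H : ℝ × ℝ → ℝ) (q : ℝ × ℝ) : ℝ := 1 / (2 * a) * partialY (lnFun H) q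
def n₂ (a : ℝ) (H : ℝ × ℝ → ℝ) (q : ℝ × ℝ) : ℝ := -(1 / (2 * a)) * partialX (lnFun H) q

def θ₃ (a : ℝ) (H : ℝ × ℝ → ℝ) : OneForm := fun p =>
  Real.sinh (2 * a * p 2) • dt
    - (-Real.sin (2 * a * p 3) * Real.cosh (2 * a * p 2) * H (p 0, p 1)
        + Real.sinh (2 * a * p 2) * l₂ a H (p 0, p 1)) • dx
    - (Real.cos (2 * a * p 3) * Real.cosh (2 * a * p 2) * H (p 0, p 1)
        + Real.sinh (2 * a * p 2) * n₂ a H (p 0, p 1)) • dy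

def θ₄ (a : ℝ) (H : ℝ × ℝ → ℝ) : OneForm := fun p =>
  dz - (Real.cos (2 * a * p 3) * H (p 0, p 1)) • dx - (Real.sin (2 * a * p 3) * H (p 0, p 1)) • dy

/-- The metric `g_Σ = h² (dx² + dy²)` and the volume form `ω_Σ = h² dx ∧ dy`, pulled back to
four-space. -/
def gSigma (h : ℝ × ℝ → ℝ) : BilinField := fun p =>
  h (p 0, p 1) ^ 2 • (dx.smulRight dx + dy.smulRight dy)
def volSigma (h : ℝ × ℝ → ℝ) : DiffForm 2 := fun p => h (p 0, p 1) ^ 2 • wedge dx dy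

/-- `g = (sinh az)² g_Σ + θ₃ ⊗ θ₃ + θ₄ ⊗ θ₄`. -/
def metric (a : ℝ) (h H : ℝ × ℝ → ℝ) : BilinField := fun p =>
  Real.sinh (a * p 2) ^ 2 • gSigma h p
    + (θ₃ a H p).smulRight (θ₃ a H p) + (θ₄ a H p).smulRight (θ₄ a H p)

/-- `α = -2a coth az`. -/
def alpha (a : ℝ) (p : R4) : ℝ := -2 * a * (Real.cosh (a * p 2) / Real.sinh (a * p 2))

/-- The distribution `span {∂_z, ∂_t}`. -/
def verticalPlane : R4 → Submodule ℝ R4 := fun _ =>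
  Submodule.span ℝ {(Pi.single 2 1 : R4), (Pi.single 3 1 : R4)}

end KahlerSurface

end

open KahlerSurface

noncomputable section

namespace KahlerSurface

/-! ### Moving frames -/

/-! Everything is read off Cartan's structure equations for the orthonormal coframe Θ = (θ₁, θ₂, θ₄,
θ₃), with θ₁ = sinh az h dx and θ₂ = sinh az h dy. If A is skew with dΘ + A ∧ Θ = 0, then ∂ + A is
the Levi-Civita connection in the frame (`IsConnectionForm.christoffel_eq`), and its curvature is dA
+ A ∧ A (`IsConnectionForm.curvature_eq`). Both almost complex structures are constant in the frame:
they rotate the (θ₁, θ₂)-plane in the same sense and the (θ₄, θ₃)-plane in opposite senses.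

The coframe is built from τ + iν = H e^{-2iat}(dx + i dy) and η = dt - l₂ dx - n₂ dy. The choice of
l₂ and n₂ gives d(τ + iν) = -2ia η ∧ (τ + iν), and the equation for Δ ln H fixes dη. Together they
make A take values in u(2) for the complex coframe θ₁ + iθ₂, θ₄ + iθ₃
(`IsSolution.isConnectionForm`). So A commutes with the standard complex structure, and J̄ is
Kähler.

With the other sign only the diagonal part of A commutes. The off-diagonal part is a coth az (θ₁ +
iθ₂) (`IsSolution.connectionForm_eq`), which is special enough for J to be integrable, and it yields
the Lee form θ = 2a coth az θ₄. Since θ is not closed, no local conformal factor makes g Kähler for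
J.

The curvature is that of complex hyperbolic space except for one coefficient K, on θ₁ ∧ θ₂ in the
horizontal block (`IsSolution.curvature_eq`). Hence the holomorphic curvature depends only on the
squared lengths of the horizontal and vertical parts of X, and the Ricci tensor is a scalar on each
of the two planes, so it is invariant under J as well. -/

/-- The metric for which the components of `Θ` form an orthonormal coframe. -/
def coframeMetric (Θ : EndField) : BilinField := fun p =>
  ∑ i : Fin 4, ((ContinuousLinearMap.proj i : R4 →L[ℝ] ℝ) ∘L Θ p).smulRight
    ((ContinuousLinearMap.proj i : R4 →L[ℝ] ℝ) ∘L Θ p)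

theorem coframeMetric_apply (Θ : EndField) (p u v : R4) :
    coframeMetric Θ p u v = Θ p u ⬝ᵥ Θ p v := by
  simp [coframeMetric, dotProduct]

/-- `A` is the Levi-Civita connection form of the orthonormal coframe `Θ` on the open set `M`. -/
structure IsConnectionForm (M : Set R4) (Θ : EndField)
    (A : R4 → R4 →L[ℝ] R4 →L[ℝ] R4) : Prop where
  isOpen : IsOpen M
  smooth : ContDiffOn ℝ ∞ Θ M
  invertible : ∀ p ∈ M, (Θ p).IsInvertible
  differentiable : ∀ p ∈ M, DifferentiableAt ℝ A p
  skew : ∀ p ∈ M, ∀ u v w, A p u v ⬝ᵥ w = -(v ⬝ᵥ A p u w)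
  torsion : ∀ p ∈ M, ∀ u v,
    fderiv ℝ Θ p u v - fderiv ℝ Θ p v u + A p u (Θ p v) - A p v (Θ p u) = 0

variable {M : Set R4} {Θ : EndField} {A : R4 → R4 →L[ℝ] R4 →L[ℝ] R4}

theorem isRiemannian_coframeMetric (hM : ContDiffOn ℝ ∞ Θ M)
    (hinv : ∀ p ∈ M, (Θ p).IsInvertible) : IsRiemannian M (coframeMetric Θ) where
  smooth := by
    unfold coframeMetric
    refine ContDiffOn.sum fun i _ => ?_
    have h1 : ContDiffOn ℝ ∞ (fun p => (ContinuousLinearMap.proj i : R4 →L[ℝ] ℝ) ∘L Θ p) M :=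
      contDiffOn_const.clm_comp hM
    exact h1.smulRight h1
  symm p _ u v := by simp only [coframeMetric_apply, dotProduct_comm]
  pos p hp u hu := by
    rw [coframeMetric_apply]
    have h1 : Θ p u ≠ 0 := fun h0 => hu ((hinv p hp).injective (by simpa using h0))
    rcases (dotProduct_self_star_nonneg (Θ p u)).lt_or_eq with h2 | h2
    · simpa using h2
    · exact absurd (dotProduct_self_eq_zero.1 (by simpa using h2.symm)) h1

namespace IsConnectionForm

variable (hA : IsConnectionForm M Θ A)
include hA

theorem contDiffAt {p : R4} (hp : p ∈ M) : ContDiffAt ℝ ∞ Θ p :=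
  hA.smooth.contDiffAt (hA.isOpen.mem_nhds hp)

theorem differentiableAt {p : R4} (hp : p ∈ M) : DifferentiableAt ℝ Θ p :=
  (hA.contDiffAt hp).differentiableAt (by simp)

theorem isRiemannian : IsRiemannian M (coframeMetric Θ) :=
  isRiemannian_coframeMetric hA.smooth hA.invertible

/-- `christoffel` is defined through `ContinuousLinearMap.inverse`, which is zero on non-invertible
maps, so nondegeneracy has to be supplied before it means anything. -/
theorem isInvertible_metric {p : R4} (hp : p ∈ M) : (coframeMetric Θ p).IsInvertible := by
  have hinj : Function.Injective (coframeMetric Θ p).toLinearMap := by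
    rw [← LinearMap.ker_eq_bot, LinearMap.ker_eq_bot']
    intro u hu
    by_contra h0
    have := hA.isRiemannian.pos p hp u h0
    have h1 : coframeMetric Θ p u = 0 := hu
    simp [h1] at this
  have hd : Module.finrank ℝ R4 = Module.finrank ℝ (R4 →L[ℝ] ℝ) := by
    rw [← (LinearMap.toContinuousLinearMap (𝕜 := ℝ) (E := R4) (F' := ℝ)).finrank_eq]
    exact (Subspace.dual_finrank_eq (K := ℝ) (V := R4)).symm
  let e := (LinearEquiv.ofInjectiveOfFinrankEq (coframeMetric Θ p).toLinearMap hinj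
    hd).toContinuousLinearEquiv
  exact ⟨e, by ext; rfl⟩

theorem fderiv_metric {p : R4} (hp : p ∈ M) (u v w : R4) :
    fderiv ℝ (coframeMetric Θ) p u v w
      = fderiv ℝ Θ p u v ⬝ᵥ Θ p w + Θ p v ⬝ᵥ fderiv ℝ Θ p u w := by
  have hg : DifferentiableAt ℝ (coframeMetric Θ) p :=
    (hA.isRiemannian.smooth.contDiffAt (hA.isOpen.mem_nhds hp)).differentiableAt (by simp)
  have hΘ := hA.differentiableAt hp
  have h1 : HasFDerivAt (fun q => coframeMetric Θ q v w) _ p :=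
    (hg.hasFDerivAt.clm_apply (hasFDerivAt_const v p)).clm_apply (hasFDerivAt_const w p)
  have h2 : ∀ x : R4, ∀ i : Fin 4, HasFDerivAt (fun q => Θ q x i)
      ((ContinuousLinearMap.proj i : R4 →L[ℝ] ℝ) ∘L (fderiv ℝ Θ p).flip x) p := fun x i => by
    have := hΘ.hasFDerivAt.clm_apply (hasFDerivAt_const x p)
    rw [hasFDerivAt_pi'] at this
    exact (this i).congr_fderiv (by ext y; simp)
  have h3 : HasFDerivAt (fun q => coframeMetric Θ q v w)
      (∑ i : Fin 4, (Θ p v i • ((ContinuousLinearMap.proj i : R4 →L[ℝ] ℝ) ∘L (fderiv ℝ Θ p).flip w)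
        + Θ p w i • ((ContinuousLinearMap.proj i : R4 →L[ℝ] ℝ) ∘L (fderiv ℝ Θ p).flip v))) p := by
    simp only [coframeMetric_apply, dotProduct]
    exact HasFDerivAt.fun_sum fun i _ => (h2 v i).mul (h2 w i)
  have h4 := congrArg (fun L : R4 →L[ℝ] ℝ => L u) (h1.unique h3)
  simp only [dotProduct, ← Finset.sum_add_distrib]
  simp at h4
  rw [h4]
  refine Finset.sum_congr rfl fun i _ => ?_
  ring

/-- Uniqueness of the Levi-Civita connection: ∂ + A in the frame is torsion-free by `torsion` and
metric by `skew`. -/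
theorem christoffel_eq {p : R4} (hp : p ∈ M) (u v : R4) :
    Θ p (christoffel (coframeMetric Θ) p u v) = fderiv ℝ Θ p u v + A p u (Θ p v) := by
  have hi := hA.invertible p hp
  have : christoffel (coframeMetric Θ) p u v
      = (Θ p).inverse (fderiv ℝ Θ p u v + A p u (Θ p v)) := by
    rw [christoffel, (hA.isInvertible_metric hp).inverse_apply_eq]
    ext1 w
    -- This is the Koszul formula: vanishing torsion exchanges the arguments of ∂Θ, and after that
    -- the terms in A cancel by skewness.
    have t1 := hA.torsion p hp u v
    have t2 := hA.torsion p hp u w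
    have t3 := hA.torsion p hp v w
    have e1 : fderiv ℝ Θ p v u = fderiv ℝ Θ p u v + A p u (Θ p v) - A p v (Θ p u) := by
      rw [← sub_eq_zero, ← neg_eq_zero, ← t1]; abel
    have e2 : fderiv ℝ Θ p w u = fderiv ℝ Θ p u w + A p u (Θ p w) - A p w (Θ p u) := by
      rw [← sub_eq_zero, ← neg_eq_zero, ← t2]; abel
    have e3 : fderiv ℝ Θ p w v = fderiv ℝ Θ p v w + A p v (Θ p w) - A p w (Θ p v) := by
      rw [← sub_eq_zero, ← neg_eq_zero, ← t3]; abel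
    simp only [coframeMetric_apply, hi.self_apply_inverse, smul_apply, sub_apply, add_apply,
      ContinuousLinearMap.flip_apply, hA.fderiv_metric hp, smul_eq_mul]
    rw [e2, e3, e1]
    simp only [dotProduct_add, add_dotProduct, sub_dotProduct, dotProduct_sub]
    have s1 := hA.skew p hp u (Θ p v) (Θ p w)
    have s2 := hA.skew p hp v (Θ p u) (Θ p w)
    have s3 := hA.skew p hp w (Θ p u) (Θ p v)
    have c1 := dotProduct_comm (Θ p u) (fderiv ℝ Θ p v w)
    have c2 := dotProduct_comm (Θ p v) (fderiv ℝ Θ p u w)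
    have c3 := dotProduct_comm (Θ p u) (A p v (Θ p w))
    have c4 := dotProduct_comm (Θ p v) (A p u (Θ p w))
    linarith
  rw [this, hi.self_apply_inverse]

/-- The second Cartan structure equation. -/
theorem curvature_eq {p : R4} (hp : p ∈ M) (u v w : R4) :
    Θ p (curvature (coframeMetric Θ) p u v w)
      = (fderiv ℝ A p u v - fderiv ℝ A p v u) (Θ p w)
        + A p u (A p v (Θ p w)) - A p v (A p u (Θ p w)) := by
  set g := coframeMetric Θ
  have hΘ := hA.differentiableAt hp
  have hΘ2 : DifferentiableAt ℝ (fderiv ℝ Θ) p :=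
    ((hA.contDiffAt hp).fderiv_right (m := 1) (by norm_cast)).differentiableAt (by simp)
  have hAd := hA.differentiable p hp
  have hΓ : ∀ v : R4, HasFDerivAt (fun q => fderiv ℝ Θ q v w + A q v (Θ q w)) _ p := fun v =>
    ((hΘ2.hasFDerivAt.clm_apply (hasFDerivAt_const v p)).clm_apply (hasFDerivAt_const w p)).add
      ((hAd.hasFDerivAt.clm_apply (hasFDerivAt_const v p)).clm_apply
        (hΘ.hasFDerivAt.clm_apply (hasFDerivAt_const w p)))
  have hinv : DifferentiableAt ℝ (fun q => (Θ q).inverse) p :=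
    (((hA.invertible p hp).contDiffAt_map_inverse (n := 1)).differentiableAt (by simp)).comp p hΘ
  have hev : ∀ v, ∀ᶠ q in nhds p,
      christoffel g q v w = (Θ q).inverse (fderiv ℝ Θ q v w + A q v (Θ q w)) := fun v => by
    filter_upwards [hA.isOpen.mem_nhds hp] with q hq
    rw [← hA.christoffel_eq hq, (hA.invertible q hq).inverse_apply_self]
  -- The product rule in `key` needs the Christoffel symbols to be differentiable beforehand; this
  -- comes from smoothness of inversion.
  have hC : ∀ v, DifferentiableAt ℝ (fun q => christoffel g q v w) p := fun v =>
    (hinv.clm_apply (hΓ v).differentiableAt).congr_of_eventuallyEq (hev v)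
  have key : ∀ u v, Θ p (fderiv ℝ (fun q => christoffel g q v w) p u
        + christoffel g p u (christoffel g p v w))
      = fderiv ℝ (fderiv ℝ Θ) p u v w + fderiv ℝ A p u v (Θ p w) + A p v (fderiv ℝ Θ p u w)
        + A p u (fderiv ℝ Θ p v w) + A p u (A p v (Θ p w)) := by
    intro u v
    have h1 : HasFDerivAt (fun q => Θ q (christoffel g q v w)) _ p :=
      hΘ.hasFDerivAt.clm_apply (hC v).hasFDerivAt
    have h2 : (fun q => fderiv ℝ Θ q v w + A q v (Θ q w)) =ᶠ[nhds p]
        fun q => Θ q (christoffel g q v w) := by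
      filter_upwards [hA.isOpen.mem_nhds hp] with q hq
      rw [hA.christoffel_eq hq]
    have h3 := congrArg (fun L : R4 →L[ℝ] R4 => L u) ((h1.congr_of_eventuallyEq h2).unique (hΓ v))
    simp at h3
    rw [map_add, hA.christoffel_eq hp u, hA.christoffel_eq hp v, map_add]
    rw [← sub_eq_zero] at h3 ⊢
    rw [← h3]
    abel
  -- The second derivatives of Θ are the only terms in `key` that do not come from A; their symmetry
  -- removes them from the curvature.
  have hsymm : fderiv ℝ (fderiv ℝ Θ) p u v = fderiv ℝ (fderiv ℝ Θ) p v u :=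
    ((hA.contDiffAt hp).isSymmSndFDerivAt (by simp; norm_cast)) u v
  have hz : ∀ x : R4, christoffel g p 0 x = 0 := fun x =>
    (hA.invertible p hp).injective (by rw [hA.christoffel_eq hp]; simp)
  have hcurv : curvature g p u v w
      = (fderiv ℝ (fun q => christoffel g q v w) p u + christoffel g p u (christoffel g p v w))
        - (fderiv ℝ (fun q => christoffel g q u w) p v
          + christoffel g p v (christoffel g p u w)) := by
    have hcov : ∀ v : R4, covDeriv g (fun _ => v) (fun _ => w)
        = fun q => christoffel g q v w := fun v => by
      ext1 q
      simp [covDeriv]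
    simp only [curvature, curvatureField, hcov]
    simp [covDeriv, VectorField.lieBracket, hz]
  rw [hcurv, map_sub, key, key, hsymm]
  simp only [sub_apply]
  abel

end IsConnectionForm

/-! ### Almost complex structures that are constant in a coframe -/

/-- The field of endomorphisms with constant matrix `J₀` in the coframe `Θ`. -/
def coframeEnd (Θ : EndField) (J₀ : R4 →L[ℝ] R4) : EndField := fun p =>
  (Θ p).inverse ∘L J₀ ∘L Θ p

section

variable {M : Set R4} {Θ : EndField} {A : R4 → R4 →L[ℝ] R4 →L[ℝ] R4} {J₀ : R4 →L[ℝ] R4}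

theorem coframeEnd_apply {p : R4} (hp : (Θ p).IsInvertible) (u : R4) :
    Θ p (coframeEnd Θ J₀ p u) = J₀ (Θ p u) := by
  simp [coframeEnd, hp.self_apply_inverse]

namespace IsConnectionForm

variable (hA : IsConnectionForm M Θ A)
include hA

theorem contDiffOn_coframeEnd (J₀ : R4 →L[ℝ] R4) : ContDiffOn ℝ ∞ (coframeEnd Θ J₀) M := by
  intro p hp
  have hinv : ContDiffAt ℝ ∞ (fun q => (Θ q).inverse) p :=
    ((hA.invertible p hp).contDiffAt_map_inverse).comp p (hA.contDiffAt hp)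
  exact (hinv.clm_comp (contDiffAt_const.clm_comp (hA.contDiffAt hp))).contDiffWithinAt

theorem isAlmostHermitian (hsq : ∀ x, J₀ (J₀ x) = -x)
    (horth : ∀ x y, J₀ x ⬝ᵥ J₀ y = x ⬝ᵥ y) :
    IsAlmostHermitian M (coframeMetric Θ) (coframeEnd Θ J₀) where
  riemannian := hA.isRiemannian
  smooth := hA.contDiffOn_coframeEnd J₀
  sq p hp u := by
    apply (hA.invertible p hp).injective
    rw [coframeEnd_apply (hA.invertible p hp), coframeEnd_apply (hA.invertible p hp), hsq, map_neg]
  orthogonal p hp u v := by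
    simp only [coframeMetric_apply, coframeEnd_apply (hA.invertible p hp), horth]

/-- Obtained by differentiating Θ J = J₀ Θ, which holds on a neighbourhood of p. -/
theorem fderiv_coframeEnd {p : R4} (hp : p ∈ M) (u v : R4) :
    Θ p (fderiv ℝ (coframeEnd Θ J₀) p u v)
      = J₀ (fderiv ℝ Θ p u v) - fderiv ℝ Θ p u (coframeEnd Θ J₀ p v) := by
  have hJ : DifferentiableAt ℝ (coframeEnd Θ J₀) p :=
    ((hA.contDiffOn_coframeEnd J₀).contDiffAt (hA.isOpen.mem_nhds hp)).differentiableAt (by simp)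
  have hΘ := hA.differentiableAt hp
  have h1 : HasFDerivAt (fun q => Θ q (coframeEnd Θ J₀ q v)) _ p :=
    hΘ.hasFDerivAt.clm_apply (hJ.hasFDerivAt.clm_apply (hasFDerivAt_const v p))
  have h2 : HasFDerivAt (fun q => J₀ (Θ q v)) _ p :=
    J₀.hasFDerivAt.comp p (hΘ.hasFDerivAt.clm_apply (hasFDerivAt_const v p))
  have h3 : (fun q => J₀ (Θ q v)) =ᶠ[nhds p] fun q => Θ q (coframeEnd Θ J₀ q v) := by
    filter_upwards [hA.isOpen.mem_nhds hp] with q hq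
    rw [coframeEnd_apply (hA.invertible q hq)]
  have h4 := congrArg (fun L : R4 →L[ℝ] R4 => L u) ((h1.congr_of_eventuallyEq h3).unique h2)
  simp at h4
  rw [← h4]
  abel

/-- The Nijenhuis tensor in terms of the connection form: it vanishes if the corresponding
algebraic expression in the commutators of `J₀` with the connection form does. -/
theorem isHermitian (hsq : ∀ x, J₀ (J₀ x) = -x) (horth : ∀ x y, J₀ x ⬝ᵥ J₀ y = x ⬝ᵥ y)
    (hN : ∀ p ∈ M, ∀ u v u' v', Θ p u' = J₀ (Θ p u) → Θ p v' = J₀ (Θ p v) →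
      (A p u' (J₀ (Θ p v)) - J₀ (A p u' (Θ p v)))
        - (A p v' (J₀ (Θ p u)) - J₀ (A p v' (Θ p u)))
        + J₀ (A p v (J₀ (Θ p u))) + A p v (Θ p u)
        - J₀ (A p u (J₀ (Θ p v))) - A p u (Θ p v) = 0) :
    IsHermitian M (coframeMetric Θ) (coframeEnd Θ J₀) where
  almost := hA.isAlmostHermitian hsq horth
  integrable X Y hX hY p hp := by
    set J := coframeEnd Θ J₀ with hJdef
    have hi := hA.invertible p hp
    have hJ : DifferentiableAt ℝ J p :=
      ((hA.contDiffOn_coframeEnd J₀).contDiffAt (hA.isOpen.mem_nhds hp)).differentiableAt (by simp)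
    have hX' : DifferentiableAt ℝ X p :=
      (hX.contDiffAt (hA.isOpen.mem_nhds hp)).differentiableAt (by simp)
    have hY' : DifferentiableAt ℝ Y p :=
      (hY.contDiffAt (hA.isOpen.mem_nhds hp)).differentiableAt (by simp)
    have hd : ∀ Z : R4 → R4, DifferentiableAt ℝ Z p → ∀ u,
        fderiv ℝ (fun q => J q (Z q)) p u = fderiv ℝ J p u (Z p) + J p (fderiv ℝ Z p u) := by
      intro Z hZ u
      rw [(hJ.hasFDerivAt.clm_apply hZ.hasFDerivAt).fderiv]
      simp [add_comm]
    have hJsq : ∀ u, J p (J p u) = -u := (hA.isAlmostHermitian hsq horth).sq p hp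
    have h1 : nijenhuis J X Y p = fderiv ℝ J p (J p (X p)) (Y p) - fderiv ℝ J p (J p (Y p)) (X p)
        + J p (fderiv ℝ J p (Y p) (X p)) - J p (fderiv ℝ J p (X p) (Y p)) := by
      simp only [nijenhuis, VectorField.lieBracket, hd X hX', hd Y hY', map_sub, map_add, hJsq]
      abel
    apply hi.injective
    have hΘJ : ∀ u, Θ p (J p u) = J₀ (Θ p u) := fun u => coframeEnd_apply hi u
    have key := hN p hp (X p) (Y p) (J p (X p)) (J p (Y p)) (hΘJ _) (hΘJ _)
    have t1 := hA.torsion p hp (X p) (Y p)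
    have t2 := hA.torsion p hp (J p (X p)) (Y p)
    have t3 := hA.torsion p hp (X p) (J p (Y p))
    have t4 := hA.torsion p hp (J p (X p)) (J p (Y p))
    have e2 := congrArg J₀ t2
    have e3 := congrArg J₀ t3
    simp only [hΘJ, map_sub, map_add, map_zero] at t1 t2 t3 t4 e2 e3
    have hf := fun u v => hA.fderiv_coframeEnd (J₀ := J₀) hp u v
    rw [h1, map_zero, map_sub, map_add, map_sub, hΘJ, hΘJ, hf, hf, hf, hf]
    simp only [map_sub, hsq]
    rw [← hJdef]
    -- With T the torsion expression, the identity added is T(X, Y) - T(JX, JY) + J₀ T(JX, Y) + J₀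
    -- T(X, JY) = 0. It trades the derivatives of Θ for terms in A, and those form the expression in
    -- `hN`.
    have := congrArg₂ (· + ·) (congrArg₂ (· - ·) (congrArg₂ (· - ·) e2 t4)
      (congrArg (fun x => -x) e3)) (congrArg₂ (· + ·) t1 key)
    simp only [add_zero, sub_zero, neg_zero] at this
    rw [← this]
    abel

end IsConnectionForm

end

/-! ### Exterior derivatives of two-forms -/

theorem twoForm_ext {ψ χ : R4 [⋀^Fin 2]→L[ℝ] ℝ} (hψ : ∀ u v, ψ ![u, v] = χ ![u, v]) : ψ = χ := by
  ext v
  have : v = ![v 0, v 1] := by ext i; fin_cases i <;> rfl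
  rw [this, hψ]

theorem threeForm_ext {ψ χ : R4 [⋀^Fin 3]→L[ℝ] ℝ}
    (hψ : ∀ u v w, ψ ![u, v, w] = χ ![u, v, w]) : ψ = χ := by
  ext v
  have : v = ![v 0, v 1, v 2] := by ext i; fin_cases i <;> rfl
  rw [this, hψ]

theorem extDeriv_twoForm_apply {ψ : DiffForm 2} {p : R4} (hψ : DifferentiableAt ℝ ψ p)
    (u v w : R4) :
    extDeriv ψ p ![u, v, w] = fderiv ℝ (fun q => ψ q ![v, w]) p u
      - fderiv ℝ (fun q => ψ q ![u, w]) p v + fderiv ℝ (fun q => ψ q ![u, v]) p w := by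
  have h0 : Fin.removeNth (0 : Fin 3) ![u, v, w] = ![v, w] := by
    ext i; fin_cases i <;> rfl
  have h1 : Fin.removeNth (1 : Fin 3) ![u, v, w] = ![u, w] := by
    ext i; fin_cases i <;> rfl
  have h2 : Fin.removeNth (2 : Fin 3) ![u, v, w] = ![u, v] := by
    ext i; fin_cases i <;> rfl
  rw [extDeriv_apply hψ]
  simp [Fin.sum_univ_three, h0, h1, h2, sub_eq_add_neg]

theorem extDeriv_smul_fun {n : ℕ} {f : R4 → ℝ} {ψ : DiffForm n} {p : R4}
    (hf : DifferentiableAt ℝ f p) (hψ : DifferentiableAt ℝ ψ p) :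
    extDeriv (fun q => f q • ψ q) p = f p • extDeriv ψ p + covWedge (fderiv ℝ f p) (ψ p) := by
  rw [extDeriv, (hf.hasFDerivAt.fun_smul hψ.hasFDerivAt).fderiv]
  simp only [extDeriv, covWedge]
  rw [ContinuousAlternatingMap.alternatizeUncurryFin_add,
    ContinuousAlternatingMap.alternatizeUncurryFin_smul]

theorem covWedge_add_left {n : ℕ} (θ η : R4 →L[ℝ] ℝ) (ψ : R4 [⋀^Fin n]→L[ℝ] ℝ) :
    covWedge (θ + η) ψ = covWedge θ ψ + covWedge η ψ := by
  rw [covWedge, covWedge, covWedge, ← ContinuousAlternatingMap.alternatizeUncurryFin_add]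
  congr 1
  ext
  simp [add_mul]

theorem covWedge_smul_left {n : ℕ} (c : ℝ) (θ : R4 →L[ℝ] ℝ) (ψ : R4 [⋀^Fin n]→L[ℝ] ℝ) :
    covWedge (c • θ) ψ = c • covWedge θ ψ := by
  rw [covWedge, covWedge, ← ContinuousAlternatingMap.alternatizeUncurryFin_smul]
  congr 1
  ext
  simp [mul_assoc]

theorem contDiffOn_kahlerForm {M : Set R4} {g : BilinField} {J : EndField}
    (hg : ContDiffOn ℝ ∞ g M) (hJ : ContDiffOn ℝ ∞ J M) : ContDiffOn ℝ ∞ (kahlerForm g J) M := by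
  have h1 : ContDiffOn ℝ ∞ (fun p => ofCovector ∘L (g p ∘L J p)) M :=
    contDiffOn_const.clm_comp (hg.clm_comp hJ)
  have h2 : ContDiffOn ℝ ∞ (fun p => (ContinuousAlternatingMap.alternatizeUncurryFin
      (ofCovector ∘L (g p ∘L J p)) : R4 [⋀^Fin 2]→L[ℝ] ℝ)) M := by
    let L : (R4 →L[ℝ] R4 [⋀^Fin 1]→L[ℝ] ℝ) →L[ℝ] R4 [⋀^Fin 2]→L[ℝ] ℝ :=
      ContinuousAlternatingMap.alternatizeUncurryFinCLM ℝ R4 ℝ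
    exact L.contDiff.comp_contDiffOn h1
  exact (contDiffOn_const (c := (1 / 2 : ℝ))).smul h2

theorem kahlerForm_smul (c : R4 → ℝ) (g : BilinField) (J : EndField) (p : R4) :
    kahlerForm (fun q => c q • g q) J p = c p • kahlerForm g J p := by
  simp only [kahlerForm]
  rw [smul_comm, ← ContinuousAlternatingMap.alternatizeUncurryFin_smul]
  ext
  simp

/-- A Hermitian surface whose Lee form is not closed is not locally conformally Kähler. -/
theorem not_isLocallyConformallyKahler {M : Set R4} (hM : IsOpen M) {g : BilinField} {J : EndField}
    (hg : ContDiffOn ℝ ∞ g M) (hJ : ContDiffOn ℝ ∞ J M) {θ : OneForm} (hθ : IsLeeForm M g J θ)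
    (hinj : ∀ q ∈ M, ∀ β, covWedge β (kahlerForm g J q) = 0 → β = 0)
    {p : R4} (hp : p ∈ M)
    (hθp : DifferentiableAt ℝ θ p) {u v : R4} (huv : fderiv ℝ θ p u v ≠ fderiv ℝ θ p v u) :
    ¬ IsLocallyConformallyKahler M g J := by
  intro hK
  obtain ⟨V, hV, hpV, hVM, σ, hσ, hKV⟩ := hK p hp
  have h1 : ∀ q ∈ V, fderiv ℝ σ q = (-2 : ℝ) • θ q := by
    intro q hq
    have hσq : DifferentiableAt ℝ σ q :=
      (hσ.contDiffAt (hV.mem_nhds hq)).differentiableAt (by simp)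
    have hΩ : DifferentiableAt ℝ (kahlerForm g J) q :=
      ((contDiffOn_kahlerForm hg hJ).contDiffAt (hM.mem_nhds (hVM hq))).differentiableAt (by simp)
    have h2 := hKV.closed q hq
    rw [funext (kahlerForm_smul (fun q => Real.exp (σ q)) g J), extDeriv_smul_fun hσq.exp hΩ,
      hθ q (hVM hq), hσq.hasFDerivAt.exp.fderiv, covWedge_smul_left, ← smul_add,
      ← covWedge_smul_left, ← covWedge_add_left] at h2
    have h3 := hinj q (hVM hq) _ ((smul_eq_zero.1 h2).resolve_left (Real.exp_ne_zero _))
    ext1 x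
    have h4 := congrArg (fun L : R4 →L[ℝ] ℝ => L x) h3
    simp only [add_apply, smul_apply, smul_eq_mul, zero_apply] at h4 ⊢
    linarith
  have h2 : fderiv ℝ σ =ᶠ[nhds p] fun q => (-2 : ℝ) • θ q := by
    filter_upwards [hV.mem_nhds hpV] with q hq using h1 q hq
  have h3 : fderiv ℝ (fderiv ℝ σ) p u v = fderiv ℝ (fderiv ℝ σ) p v u :=
    ((hσ.contDiffAt (hV.mem_nhds hpV)).isSymmSndFDerivAt (by simp; norm_cast)) u v
  rw [h2.fderiv_eq, fderiv_fun_const_smul hθp] at h3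
  simp at h3
  exact huv h3

section

variable {M : Set R4} {Θ : EndField} {A : R4 → R4 →L[ℝ] R4 →L[ℝ] R4} {J₀ : R4 →L[ℝ] R4}

namespace IsConnectionForm

variable (hA : IsConnectionForm M Θ A)
include hA

theorem kahlerForm_apply (hsq : ∀ x, J₀ (J₀ x) = -x) (horth : ∀ x y, J₀ x ⬝ᵥ J₀ y = x ⬝ᵥ y)
    {p : R4} (hp : p ∈ M) (u v : R4) :
    kahlerForm (coframeMetric Θ) (coframeEnd Θ J₀) p ![u, v] = J₀ (Θ p u) ⬝ᵥ Θ p v := by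
  rw [KahlerSurface.kahlerForm_apply (hA.isAlmostHermitian hsq horth) hp, coframeMetric_apply,
    coframeEnd_apply (hA.invertible p hp)]

/-- In the frame Ω has constant coefficients, so dΩ involves only the antisymmetrized derivative of
Θ, and vanishing torsion expresses that through A. -/
theorem extDeriv_kahlerForm (hsq : ∀ x, J₀ (J₀ x) = -x) (horth : ∀ x y, J₀ x ⬝ᵥ J₀ y = x ⬝ᵥ y)
    {p : R4} (hp : p ∈ M) (u v w : R4) :
    extDeriv (kahlerForm (coframeMetric Θ) (coframeEnd Θ J₀)) p ![u, v, w]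
      = J₀ (A p v (Θ p u) - A p u (Θ p v)) ⬝ᵥ Θ p w
        - J₀ (A p w (Θ p u) - A p u (Θ p w)) ⬝ᵥ Θ p v
        + J₀ (A p w (Θ p v) - A p v (Θ p w)) ⬝ᵥ Θ p u := by
  have hΩ : DifferentiableAt ℝ (kahlerForm (coframeMetric Θ) (coframeEnd Θ J₀)) p :=
    ((contDiffOn_kahlerForm hA.isRiemannian.smooth (hA.contDiffOn_coframeEnd J₀)).contDiffAt
      (hA.isOpen.mem_nhds hp)).differentiableAt (by simp)
  have hΘ := hA.differentiableAt hp
  have hc : ∀ x : R4, HasFDerivAt (fun q => Θ q x) ((fderiv ℝ Θ p).flip x) p := fun x =>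
    (hΘ.hasFDerivAt.clm_apply (hasFDerivAt_const x p)).congr_fderiv (by ext; simp)
  have hd : ∀ x y z : R4,
      fderiv ℝ (fun q => kahlerForm (coframeMetric Θ) (coframeEnd Θ J₀) q ![y, z]) p x
        = J₀ (fderiv ℝ Θ p x y) ⬝ᵥ Θ p z + J₀ (Θ p y) ⬝ᵥ fderiv ℝ Θ p x z := by
    intro x y z
    have h1 : (fun q => kahlerForm (coframeMetric Θ) (coframeEnd Θ J₀) q ![y, z]) =ᶠ[nhds p]
        fun q => ∑ i, J₀ (Θ q y) i * Θ q z i := by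
      filter_upwards [hA.isOpen.mem_nhds hp] with q hq
      rw [hA.kahlerForm_apply hsq horth hq, dotProduct]
    have h2 : ∀ i : Fin 4, HasFDerivAt (fun q => J₀ (Θ q y) i)
        ((ContinuousLinearMap.proj i : R4 →L[ℝ] ℝ) ∘L J₀ ∘L (fderiv ℝ Θ p).flip y) p := fun i =>
      hasFDerivAt_pi'.1 (J₀.hasFDerivAt.comp p (hc y)) i
    have h3 : ∀ i : Fin 4, HasFDerivAt (fun q => Θ q z i)
        ((ContinuousLinearMap.proj i : R4 →L[ℝ] ℝ) ∘L (fderiv ℝ Θ p).flip z) p := fun i =>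
      hasFDerivAt_pi'.1 (hc z) i
    have h4 := HasFDerivAt.fun_sum (u := Finset.univ) fun i _ => (h2 i).fun_mul (h3 i)
    rw [h1.fderiv_eq, h4.fderiv]
    simp only [dotProduct, ← Finset.sum_add_distrib]
    simp
    refine Finset.sum_congr rfl fun i _ => ?_
    ring
  have hskew : ∀ x y, J₀ x ⬝ᵥ y = -(J₀ y ⬝ᵥ x) := fun x y => by
    rw [← horth (J₀ x) y, hsq, neg_dotProduct, dotProduct_comm]
  have ht : ∀ x y, A p y (Θ p x) - A p x (Θ p y) = fderiv ℝ Θ p x y - fderiv ℝ Θ p y x := by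
    intro x y
    have := hA.torsion p hp x y
    rw [← sub_eq_zero, ← neg_eq_zero, ← this]
    abel
  rw [extDeriv_twoForm_apply hΩ, hd, hd, hd, ht, ht, ht,
    hskew (Θ p v) (fderiv ℝ Θ p u w), hskew (Θ p u) (fderiv ℝ Θ p v w),
    hskew (Θ p u) (fderiv ℝ Θ p w v)]
  simp only [map_sub, sub_dotProduct]
  ring

/-- The trace is unchanged by conjugation with Θ p, so Ricci may be computed in the frame. -/
theorem ricci_eq {p : R4} (hp : p ∈ M) (u v : R4) (L : R4 →ₗ[ℝ] R4)
    (hL : ∀ w, Θ p (curvature (coframeMetric Θ) p w u v) = L (Θ p w)) :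
    ricci (coframeMetric Θ) p u v = ∑ i, L (Pi.single i 1) i := by
  obtain ⟨e, he⟩ := hA.invertible p hp
  have h1 : ∀ w, curvature (coframeMetric Θ) p w u v = e.symm (L (e w)) := fun w => by
    rw [ContinuousLinearEquiv.eq_symm_apply]
    have := hL w
    rw [← he] at this
    exact this
  have htr : ∀ T : R4 →ₗ[ℝ] R4, LinearMap.trace ℝ R4 T = ∑ i, T (Pi.single i 1) i := fun T => by
    rw [LinearMap.trace_eq_matrix_trace ℝ (Pi.basisFun ℝ (Fin 4)), Matrix.trace]
    simp
  rw [← htr, ← LinearMap.trace_conj' L e.symm.toLinearEquiv, htr, ricci]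
  exact Finset.sum_congr rfl fun i _ => by rw [h1]; rfl

end IsConnectionForm

end

/-! ### The two standard complex structures of opposite orientation -/

/-- The complex structure `x₀ + i x₁`, `x₂ + ε i x₃` of four-space, for `ε = ±1`. -/
def stdComplex (ε : ℝ) : R4 →L[ℝ] R4 :=
  ContinuousLinearMap.pi ![-ContinuousLinearMap.proj 1, ContinuousLinearMap.proj 0,
    (-ε) • ContinuousLinearMap.proj 3, ε • ContinuousLinearMap.proj 2]

theorem stdComplex_apply (ε : ℝ) (x : R4) :
    stdComplex ε x = ![-x 1, x 0, -ε * x 3, ε * x 2] := by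
  ext i
  fin_cases i <;> simp [stdComplex]

theorem dotProduct_four (x y : R4) :
    x ⬝ᵥ y = x 0 * y 0 + x 1 * y 1 + x 2 * y 2 + x 3 * y 3 := by
  simp [dotProduct, Fin.sum_univ_four]

variable {ε : ℝ} (hε : ε ^ 2 = 1)

include hε in
theorem stdComplex_sq (x : R4) : stdComplex ε (stdComplex ε x) = -x := by
  ext i
  fin_cases i <;> simp [stdComplex_apply]
  · linear_combination x 2 * hε
  · linear_combination x 3 * hε

include hε in
theorem stdComplex_dotProduct (x y : R4) : stdComplex ε x ⬝ᵥ stdComplex ε y = x ⬝ᵥ y := by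
  simp only [dotProduct_four, stdComplex_apply]
  simp
  linear_combination (x 2 * y 2 + x 3 * y 3) * hε

include hε in
/-- In four dimensions, the two-forms `x⁰ ∧ x¹ + ε x² ∧ x³` are self-dual (`ε = 1`) and
anti-self-dual (`ε = -1`): their values on complementary pairs of columns of a rotation agree
up to the sign `ε`. -/
theorem minor_eq_complementary_minor (A : Matrix (Fin 4) (Fin 4) ℝ) (hA : A.transpose * A = 1)
    (hdet : 0 < A.det) :
    A 0 2 * A 1 3 - A 1 2 * A 0 3 + ε * (A 2 2 * A 3 3 - A 3 2 * A 2 3)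
      = ε * (A 0 0 * A 1 1 - A 1 0 * A 0 1 + ε * (A 2 0 * A 3 1 - A 3 0 * A 2 1)) := by
  have hA' : A * A.transpose = 1 := mul_eq_one_comm.1 hA
  have hdet1 : A.det = 1 := by
    have h1 := congrArg Matrix.det hA
    rw [Matrix.det_mul, Matrix.det_transpose, Matrix.det_one] at h1
    nlinarith
  have hdet2 := hdet1
  rw [Matrix.det_succ_row_zero] at hdet2
  simp [Fin.sum_univ_four, Matrix.det_fin_three, Matrix.submatrix_apply, Fin.succAbove] at hdet2
  have hG : ∀ i j, A i 0 * A j 0 + A i 1 * A j 1 + A i 2 * A j 2 + A i 3 * A j 3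
      = if i = j then 1 else 0 := fun i j => by
    have := congrFun (congrFun hA' i) j
    simpa [Matrix.mul_apply, Fin.sum_univ_four, Matrix.one_apply] using this
  have h00 := hG 0 0
  have h11 := hG 1 1
  have h22 := hG 2 2
  have h33 := hG 3 3
  have h01 := hG 0 1
  have h23 := hG 2 3
  have h02 := hG 0 2
  have h03 := hG 0 3
  simp at h00 h11 h22 h33 h01 h23 h02 h03
  set w : Fin 4 → Fin 4 → ℝ := fun i j =>
    A 0 i * A 1 j - A 1 i * A 0 j + ε * (A 2 i * A 3 j - A 3 i * A 2 j) with hw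
  -- Here w holds the values of ω = x⁰ ∧ x¹ + ε x² ∧ x³ on pairs of columns. The sum of squares is
  -- |ω|² - 2ε Pf(w), where |ω|² = 2 by orthonormality of the rows and Pf(w) = ε det A = ε, so it
  -- vanishes.
  have hsum : (w 2 3 - ε * w 0 1) ^ 2 + ((w 0 2 + ε * w 1 3) ^ 2 + (w 0 3 - ε * w 1 2) ^ 2)
      = 0 := by
    simp only [hw]
    rcases sq_eq_sq_iff_eq_or_eq_neg.1 (hε.trans (one_pow 2).symm) with rfl | rfl
    · linear_combination
        (A 1 0 * A 1 0 + A 1 1 * A 1 1 + A 1 2 * A 1 2 + A 1 3 * A 1 3) * h00 + h11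
          + (A 3 0 * A 3 0 + A 3 1 * A 3 1 + A 3 2 * A 3 2 + A 3 3 * A 3 3) * h22 + h33
          - (A 0 0 * A 1 0 + A 0 1 * A 1 1 + A 0 2 * A 1 2 + A 0 3 * A 1 3) * h01
          - (A 2 0 * A 3 0 + A 2 1 * A 3 1 + A 2 2 * A 3 2 + A 2 3 * A 3 3) * h23
        + 2 * (A 1 0 * A 3 0 + A 1 1 * A 3 1 + A 1 2 * A 3 2 + A 1 3 * A 3 3) * h02
          - 2 * (A 1 0 * A 2 0 + A 1 1 * A 2 1 + A 1 2 * A 2 2 + A 1 3 * A 2 3) * h03 - 2 * hdet2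
    · linear_combination
        (A 1 0 * A 1 0 + A 1 1 * A 1 1 + A 1 2 * A 1 2 + A 1 3 * A 1 3) * h00 + h11
          + (A 3 0 * A 3 0 + A 3 1 * A 3 1 + A 3 2 * A 3 2 + A 3 3 * A 3 3) * h22 + h33
          - (A 0 0 * A 1 0 + A 0 1 * A 1 1 + A 0 2 * A 1 2 + A 0 3 * A 1 3) * h01
          - (A 2 0 * A 3 0 + A 2 1 * A 3 1 + A 2 2 * A 3 2 + A 2 3 * A 3 3) * h23
        - 2 * (A 1 0 * A 3 0 + A 1 1 * A 3 1 + A 1 2 * A 3 2 + A 1 3 * A 3 3) * h02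
          + 2 * (A 1 0 * A 2 0 + A 1 1 * A 2 1 + A 1 2 * A 2 2 + A 1 3 * A 2 3) * h03 - 2 * hdet2
  have h0 : (w 2 3 - ε * w 0 1) ^ 2 = 0 :=
    le_antisymm (by rw [← hsum]; exact le_add_of_nonneg_right (by positivity)) (sq_nonneg _)
  exact sub_eq_zero.1 (pow_eq_zero_iff two_ne_zero |>.1 h0)

/-- The Kähler forms of the two structures `stdComplex (± 1)` in a coframe are self-dual and
anti-self-dual for the same orientation. -/
theorem exists_orientation {M : Set R4} {Θ : EndField} {A : R4 → R4 →L[ℝ] R4 →L[ℝ] R4}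
    (hA : IsConnectionForm M Θ A) {p : R4} (hp : p ∈ M) :
    ∃ o : Orientation ℝ R4 (Fin 4),
      IsSelfDual (coframeMetric Θ p) o
        (kahlerForm (coframeMetric Θ) (coframeEnd Θ (stdComplex 1)) p) ∧
      IsAntiSelfDual (coframeMetric Θ p) o
        (kahlerForm (coframeMetric Θ) (coframeEnd Θ (stdComplex (-1))) p) := by
  obtain ⟨e, he⟩ := hA.invertible p hp
  let f : Module.Basis (Fin 4) ℝ R4 := Module.Basis.ofEquivFun e.toLinearEquiv
  have key : ∀ ε : ℝ, ε ^ 2 = 1 → ∀ b : Module.Basis (Fin 4) ℝ R4,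
      IsOrthonormalBasis (coframeMetric Θ p) b → b.orientation = f.orientation →
      kahlerForm (coframeMetric Θ) (coframeEnd Θ (stdComplex ε)) p ![b 2, b 3]
        = ε * kahlerForm (coframeMetric Θ) (coframeEnd Θ (stdComplex ε)) p ![b 0, b 1] := by
    intro ε hε b hb hbo
    have hdet := (Module.Basis.orientation_eq_iff_det_pos f b).1 hbo.symm
    rw [Module.Basis.det_apply] at hdet
    have hf : ∀ i j, f.toMatrix b i j = Θ p (b j) i := fun i j => by
      rw [← he]; rfl
    have horth : (f.toMatrix b).transpose * f.toMatrix b = 1 := by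
      ext i j
      have := hb i j
      rw [coframeMetric_apply] at this
      simpa [Matrix.mul_apply, hf, dotProduct, Matrix.one_apply] using this
    have := minor_eq_complementary_minor hε _ horth hdet
    simp only [hf] at this
    rw [hA.kahlerForm_apply (stdComplex_sq hε) (stdComplex_dotProduct hε) hp,
      hA.kahlerForm_apply (stdComplex_sq hε) (stdComplex_dotProduct hε) hp]
    simp only [dotProduct_four, stdComplex_apply]
    simp
    linear_combination this
  refine ⟨f.orientation, fun b hb hbo => ?_, fun b hb hbo => ?_⟩
  · simpa using key 1 (by norm_num) b hb hbo
  · simpa using key (-1) (by norm_num) b hb hbo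

/-! ### Exterior derivatives of one-forms -/

/-- `β` is the exterior derivative of the one-form `θ` at `p`. -/
def HasExtDerivAt (θ : OneForm) (β : R4 → R4 → ℝ) (p : R4) : Prop :=
  DifferentiableAt ℝ θ p ∧ ∀ u v, fderiv ℝ θ p u v - fderiv ℝ θ p v u = β u v

namespace HasExtDerivAt

variable {θ η : OneForm} {β γ : R4 → R4 → ℝ} {p : R4}

theorem congr (hθ : HasExtDerivAt θ β p) (hβ : ∀ u v, β u v = γ u v) : HasExtDerivAt θ γ p :=
  ⟨hθ.1, fun u v => (hθ.2 u v).trans (hβ u v)⟩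

theorem const (θ : R4 →L[ℝ] ℝ) (p : R4) : HasExtDerivAt (fun _ => θ) (fun _ _ => 0) p :=
  ⟨differentiableAt_const _, fun u v => by simp⟩

theorem add (hθ : HasExtDerivAt θ β p) (hη : HasExtDerivAt η γ p) :
    HasExtDerivAt (fun q => θ q + η q) (fun u v => β u v + γ u v) p :=
  ⟨hθ.1.fun_add hη.1, fun u v => by
    rw [fderiv_fun_add hθ.1 hη.1]
    beta_reduce
    rw [← hθ.2, ← hη.2]
    simp only [add_apply]
    ring⟩

theorem sub (hθ : HasExtDerivAt θ β p) (hη : HasExtDerivAt η γ p) :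
    HasExtDerivAt (fun q => θ q - η q) (fun u v => β u v - γ u v) p :=
  ⟨hθ.1.fun_sub hη.1, fun u v => by
    rw [fderiv_fun_sub hθ.1 hη.1]
    beta_reduce
    rw [← hθ.2, ← hη.2]
    simp only [sub_apply]
    ring⟩

theorem smul {f : R4 → ℝ} {f' : R4 →L[ℝ] ℝ} (hf : HasFDerivAt f f' p)
    (hθ : HasExtDerivAt θ β p) :
    HasExtDerivAt (fun q => f q • θ q)
      (fun u v => f' u * θ p v - f' v * θ p u + f p * β u v) p :=
  ⟨hf.differentiableAt.fun_smul hθ.1, fun u v => by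
    rw [(hf.fun_smul hθ.1.hasFDerivAt).fderiv]
    beta_reduce
    rw [← hθ.2]
    simp
    ring⟩

end HasExtDerivAt

section

variable {F : Type*} [NormedAddCommGroup F] [NormedSpace ℝ F] {θ : OneForm} {p : R4}

theorem hasFDerivAt_smulRight (hθ : DifferentiableAt ℝ θ p) (c : F) :
    HasFDerivAt (fun q => (θ q).smulRight c)
      ((ContinuousLinearMap.smulRightL ℝ R4 F).flip c ∘L fderiv ℝ θ p) p :=
  ((ContinuousLinearMap.smulRightL ℝ R4 F).flip c).hasFDerivAt.comp p hθ.hasFDerivAt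

theorem smulRightL_flip_comp_apply (L : R4 →L[ℝ] R4 →L[ℝ] ℝ) (c : F) (u v : R4) :
    ((ContinuousLinearMap.smulRightL ℝ R4 F).flip c ∘L L) u v = L u v • c := rfl

end

/-! ### Functions of the coordinates -/

section

variable {U : Set (ℝ × ℝ)} {f : ℝ × ℝ → ℝ}

theorem hasFDerivAt_base {p : R4} (hf : DifferentiableAt ℝ f (p 0, p 1)) :
    HasFDerivAt (fun q : R4 => f (q 0, q 1))
      (partialX f (p 0, p 1) • dx + partialY f (p 0, p 1) • dy) p := by
  have h1 : HasFDerivAt (fun q : R4 => (q 0, q 1)) (dx.prod dy) p := (dx.prod dy).hasFDerivAt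
  refine (hf.hasFDerivAt.comp p h1).congr_fderiv ?_
  ext u
  have : (dx u, dy u) = dx u • ((1, 0) : ℝ × ℝ) + dy u • ((0, 1) : ℝ × ℝ) := by simp
  simp only [ContinuousLinearMap.comp_apply, ContinuousLinearMap.prod_apply, add_apply, smul_apply,
    smul_eq_mul, partialX, partialY]
  rw [this, map_add, map_smul, map_smul]
  simp [mul_comm]

theorem hasFDerivAt_comp_coord {f : ℝ → ℝ} {f' : ℝ} (b : ℝ) (i : Fin 4) {p : R4}
    (hf : HasDerivAt f f' (b * p i)) :
    HasFDerivAt (fun q : R4 => f (b * q i))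
      ((f' * b) • (ContinuousLinearMap.proj i : R4 →L[ℝ] ℝ)) p := by
  have h1 : HasFDerivAt (fun q : R4 => b * q i)
      (b • (ContinuousLinearMap.proj i : R4 →L[ℝ] ℝ)) p :=
    (ContinuousLinearMap.proj (R := ℝ) (φ := fun _ : Fin 4 => ℝ) i).hasFDerivAt.const_mul b
  have := hf.comp_hasFDerivAt p h1
  rwa [smul_smul] at this

theorem contDiffOn_partialX (hU : IsOpen U) (hf : ContDiffOn ℝ ∞ f U) :
    ContDiffOn ℝ ∞ (partialX f) U :=
  (hf.fderiv_of_isOpen hU (by simp)).clm_apply contDiffOn_const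

theorem contDiffOn_partialY (hU : IsOpen U) (hf : ContDiffOn ℝ ∞ f U) :
    ContDiffOn ℝ ∞ (partialY f) U :=
  (hf.fderiv_of_isOpen hU (by simp)).clm_apply contDiffOn_const

theorem contDiffOn_lnFun (hf : ContDiffOn ℝ ∞ f U) (hpos : ∀ q ∈ U, 0 < f q) :
    ContDiffOn ℝ ∞ (lnFun f) U :=
  hf.log fun q hq => (hpos q hq).ne'

theorem mul_partial_lnFun {q : ℝ × ℝ} (hf : DifferentiableAt ℝ f q) (hpos : 0 < f q) :
    partialX f q = f q * partialX (lnFun f) q ∧ partialY f q = f q * partialY (lnFun f) q := by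
  have h1 : fderiv ℝ (lnFun f) q = (f q)⁻¹ • fderiv ℝ f q :=
    (hf.hasFDerivAt.log hpos.ne').fderiv
  constructor <;> simp [partialX, partialY, h1, hpos.ne']

theorem isOpen_totalSpace (hU : IsOpen U) : IsOpen (totalSpace U) := by
  have h1 : Continuous fun p : R4 => (p 0, p 1) := by fun_prop
  have h2 : Continuous fun p : R4 => p 2 := by fun_prop
  exact (hU.preimage h1).inter (isOpen_lt h2 continuous_const)

theorem contDiffOn_base (hf : ContDiffOn ℝ ∞ f U) :
    ContDiffOn ℝ ∞ (fun p : R4 => f (p 0, p 1)) (totalSpace U) := by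
  have h1 : ContDiff ℝ ∞ fun p : R4 => (p 0, p 1) := by fun_prop
  exact hf.comp h1.contDiffOn fun p hp => hp.1

end

@[simp] theorem dx_apply (u : R4) : dx u = u 0 := rfl
@[simp] theorem dy_apply (u : R4) : dy u = u 1 := rfl
@[simp] theorem dz_apply (u : R4) : dz u = u 2 := rfl
@[simp] theorem dt_apply (u : R4) : dt u = u 3 := rfl

/-! ### The coframe and its structure equations -/

/-- The hypotheses on the two functions from which the metric is built. -/
structure IsSolution (a : ℝ) (U : Set (ℝ × ℝ)) (h H : ℝ × ℝ → ℝ) : Prop where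
  a_ne : a ≠ 0
  isOpen : IsOpen U
  smooth_h : ContDiffOn ℝ ∞ h U
  pos_h : ∀ q ∈ U, 0 < h q
  smooth_H : ContDiffOn ℝ ∞ H U
  pos_H : ∀ q ∈ U, 0 < H q
  laplacian : ∀ q ∈ U,
    flatLaplacian (lnFun H) q = 2 * a ^ 2 * h q ^ 2 + 4 * a ^ 2 * H q ^ 2

/-- `H (cos 2at dx + sin 2at dy)`. -/
def tau (a : ℝ) (H : ℝ × ℝ → ℝ) : OneForm := fun p =>
  (Real.cos (2 * a * p 3) * H (p 0, p 1)) • dx + (Real.sin (2 * a * p 3) * H (p 0, p 1)) • dy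

/-- `H (cos 2at dy - sin 2at dx)`. -/
def nu (a : ℝ) (H : ℝ × ℝ → ℝ) : OneForm := fun p =>
  (Real.cos (2 * a * p 3) * H (p 0, p 1)) • dy - (Real.sin (2 * a * p 3) * H (p 0, p 1)) • dx

/-- `dt - l₂ dx - n₂ dy`. -/
def eta (a : ℝ) (H : ℝ × ℝ → ℝ) : OneForm := fun p =>
  dt - l₂ a H (p 0, p 1) • dx - n₂ a H (p 0, p 1) • dy

/-- `(ln h)_x dy - (ln h)_y dx`. -/
def conjDLog (h : ℝ × ℝ → ℝ) : OneForm := fun p =>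
  partialX (lnFun h) (p 0, p 1) • dy - partialY (lnFun h) (p 0, p 1) • dx

/-- `sinh az h dx` and `sinh az h dy`. -/
def θ₁ (a : ℝ) (h : ℝ × ℝ → ℝ) : OneForm := fun p => (Real.sinh (a * p 2) * h (p 0, p 1)) • dx
def θ₂ (a : ℝ) (h : ℝ × ℝ → ℝ) : OneForm := fun p => (Real.sinh (a * p 2) * h (p 0, p 1)) • dy

theorem tau_apply (a : ℝ) (H : ℝ × ℝ → ℝ) (p u : R4) : tau a H p u
    = H (p 0, p 1) * (Real.cos (2 * a * p 3) * u 0 + Real.sin (2 * a * p 3) * u 1) := by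
  simp [tau]; ring

theorem nu_apply (a : ℝ) (H : ℝ × ℝ → ℝ) (p u : R4) : nu a H p u
    = H (p 0, p 1) * (Real.cos (2 * a * p 3) * u 1 - Real.sin (2 * a * p 3) * u 0) := by
  simp [nu]; ring

theorem eta_apply (a : ℝ) (H : ℝ × ℝ → ℝ) (p u : R4) : eta a H p u
    = u 3 - l₂ a H (p 0, p 1) * u 0 - n₂ a H (p 0, p 1) * u 1 := by
  simp [eta]

theorem conjDLog_apply (h : ℝ × ℝ → ℝ) (p u : R4) : conjDLog h p u
    = partialX (lnFun h) (p 0, p 1) * u 1 - partialY (lnFun h) (p 0, p 1) * u 0 := by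
  simp [conjDLog]

theorem θ₁_apply (a : ℝ) (h : ℝ × ℝ → ℝ) (p u : R4) :
    θ₁ a h p u = Real.sinh (a * p 2) * h (p 0, p 1) * u 0 := by
  simp [θ₁]

theorem θ₂_apply (a : ℝ) (h : ℝ × ℝ → ℝ) (p u : R4) :
    θ₂ a h p u = Real.sinh (a * p 2) * h (p 0, p 1) * u 1 := by
  simp [θ₂]

theorem θ₄_eq (a : ℝ) (H : ℝ × ℝ → ℝ) : θ₄ a H = fun p => dz - tau a H p := by
  ext p u
  simp [θ₄, tau]
  ring

theorem θ₃_eq (a : ℝ) (H : ℝ × ℝ → ℝ) :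
    θ₃ a H = fun p => Real.sinh (2 * a * p 2) • eta a H p - Real.cosh (2 * a * p 2) • nu a H p := by
  ext p u
  simp [θ₃, eta, nu]
  ring

/-- With every hyperbolic function written in sinh az and cosh az, the only relation left for the
algebra is cosh² = 1 + sinh². -/
theorem sinh_double (a : ℝ) (z : ℝ) :
    Real.sinh (2 * a * z) = 2 * Real.sinh (a * z) * Real.cosh (a * z) := by
  rw [mul_assoc, Real.sinh_two_mul]

theorem cosh_double (a : ℝ) (z : ℝ) : Real.cosh (2 * a * z) = 1 + 2 * Real.sinh (a * z) ^ 2 := by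
  rw [mul_assoc, Real.cosh_two_mul, Real.cosh_sq]
  ring

theorem θ₄_apply (a : ℝ) (H : ℝ × ℝ → ℝ) (p u : R4) : θ₄ a H p u = u 2 - tau a H p u := by
  simp [θ₄_eq]

theorem θ₃_apply (a : ℝ) (H : ℝ × ℝ → ℝ) (p u : R4) :
    θ₃ a H p u = 2 * Real.sinh (a * p 2) * Real.cosh (a * p 2) * eta a H p u
      - (1 + 2 * Real.sinh (a * p 2) ^ 2) * nu a H p u := by
  simp [θ₃_eq, sinh_double, cosh_double]

/-- The coframe `(θ₁, θ₂, θ₄, θ₃)`. -/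
def coframe (a : ℝ) (h H : ℝ × ℝ → ℝ) : EndField := fun p =>
  (θ₁ a h p).smulRight (Pi.single 0 1) + (θ₂ a h p).smulRight (Pi.single 1 1)
    + (θ₄ a H p).smulRight (Pi.single 2 1) + (θ₃ a H p).smulRight (Pi.single 3 1)

theorem coframe_apply (a : ℝ) (h H : ℝ × ℝ → ℝ) (p u : R4) :
    coframe a h H p u = ![θ₁ a h p u, θ₂ a h p u, θ₄ a H p u, θ₃ a H p u] := by
  ext i
  fin_cases i <;> simp [coframe]

theorem metric_eq (a : ℝ) (h H : ℝ × ℝ → ℝ) : metric a h H = coframeMetric (coframe a h H) := by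
  ext p u v
  rw [coframeMetric_apply, dotProduct_four, coframe_apply, coframe_apply]
  simp [metric, gSigma, θ₁_apply, θ₂_apply]
  ring

namespace IsSolution

variable {a : ℝ} {U : Set (ℝ × ℝ)} {h H : ℝ × ℝ → ℝ} (hs : IsSolution a U h H)
  {p : R4} (hp : p ∈ totalSpace U)
include hs hp

theorem sinh_ne : Real.sinh (a * p 2) ≠ 0 :=
  Real.sinh_ne_zero.2 (mul_ne_zero hs.a_ne hp.2.ne)

theorem h_ne : h (p 0, p 1) ≠ 0 := (hs.pos_h _ hp.1).ne'

theorem H_ne : H (p 0, p 1) ≠ 0 := (hs.pos_H _ hp.1).ne'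

theorem isInvertible_coframe : (coframe a h H p).IsInvertible := by
  have hinj : Function.Injective (coframe a h H p).toLinearMap := by
    rw [← LinearMap.ker_eq_bot, LinearMap.ker_eq_bot']
    intro u hu
    have hu' : coframe a h H p u = 0 := hu
    rw [coframe_apply] at hu'
    have h0 := congrFun hu' 0
    have h1 := congrFun hu' 1
    have h2 := congrFun hu' 2
    have h3 := congrFun hu' 3
    simp [θ₁_apply, θ₂_apply, hs.sinh_ne hp, hs.h_ne hp] at h0 h1
    simp [θ₄_apply, tau_apply, h0, h1] at h2
    simp [θ₃_apply, nu_apply, eta_apply, h0, h1, hs.sinh_ne hp, (Real.cosh_pos _).ne'] at h3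
    ext i
    fin_cases i <;> simpa
  exact ⟨(LinearEquiv.ofInjectiveEndo _ hinj).toContinuousLinearEquiv, by ext; rfl⟩

omit hp in
theorem contDiffOn_coframe : ContDiffOn ℝ ∞ (coframe a h H) (totalSpace U) := by
  have hh := contDiffOn_base hs.smooth_h
  have hH := contDiffOn_base hs.smooth_H
  have hl : ContDiffOn ℝ ∞ (fun p : R4 => l₂ a H (p 0, p 1)) (totalSpace U) :=
    contDiffOn_const.mul (contDiffOn_base (contDiffOn_partialY hs.isOpen
      (contDiffOn_lnFun hs.smooth_H hs.pos_H)))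
  have hn : ContDiffOn ℝ ∞ (fun p : R4 => n₂ a H (p 0, p 1)) (totalSpace U) :=
    contDiffOn_const.mul (contDiffOn_base (contDiffOn_partialX hs.isOpen
      (contDiffOn_lnFun hs.smooth_H hs.pos_H)))
  have hsin : ContDiffOn ℝ ∞ (fun p : R4 => Real.sin (2 * a * p 3)) (totalSpace U) := by fun_prop
  have hcos : ContDiffOn ℝ ∞ (fun p : R4 => Real.cos (2 * a * p 3)) (totalSpace U) := by fun_prop
  have hs1 : ContDiffOn ℝ ∞ (fun p : R4 => Real.sinh (a * p 2)) (totalSpace U) := by fun_prop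
  have hs2 : ContDiffOn ℝ ∞ (fun p : R4 => Real.sinh (2 * a * p 2)) (totalSpace U) := by fun_prop
  have hc2 : ContDiffOn ℝ ∞ (fun p : R4 => Real.cosh (2 * a * p 2)) (totalSpace U) := by fun_prop
  have h1 : ContDiffOn ℝ ∞ (θ₁ a h) (totalSpace U) := (hs1.mul hh).smul contDiffOn_const
  have h2 : ContDiffOn ℝ ∞ (θ₂ a h) (totalSpace U) := (hs1.mul hh).smul contDiffOn_const
  have ht : ContDiffOn ℝ ∞ (tau a H) (totalSpace U) :=
    ((hcos.mul hH).smul contDiffOn_const).add ((hsin.mul hH).smul contDiffOn_const)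
  have hν : ContDiffOn ℝ ∞ (nu a H) (totalSpace U) :=
    ((hcos.mul hH).smul contDiffOn_const).sub ((hsin.mul hH).smul contDiffOn_const)
  have hη : ContDiffOn ℝ ∞ (eta a H) (totalSpace U) :=
    (contDiffOn_const.sub (hl.smul contDiffOn_const)).sub (hn.smul contDiffOn_const)
  have h4 : ContDiffOn ℝ ∞ (θ₄ a H) (totalSpace U) := by
    rw [θ₄_eq]; exact contDiffOn_const.sub ht
  have h3 : ContDiffOn ℝ ∞ (θ₃ a H) (totalSpace U) := by
    rw [θ₃_eq]; exact (hs2.smul hη).sub (hc2.smul hν)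
  exact (((h1.smulRight contDiffOn_const).add (h2.smulRight contDiffOn_const)).add
    (h4.smulRight contDiffOn_const)).add (h3.smulRight contDiffOn_const)

end IsSolution

/-! ### Exterior derivatives of the building blocks -/

namespace IsSolution

variable {a : ℝ} {U : Set (ℝ × ℝ)} {h H : ℝ × ℝ → ℝ} (hs : IsSolution a U h H)
  {p : R4} (hp : p ∈ totalSpace U)
include hs hp

theorem differentiableAt_of_contDiffOn {f : ℝ × ℝ → ℝ} (hf : ContDiffOn ℝ ∞ f U) :
    DifferentiableAt ℝ f (p 0, p 1) :=
  (hf.contDiffAt (hs.isOpen.mem_nhds hp.1)).differentiableAt (by simp)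

theorem hasFDerivAt_log_mul {f : ℝ × ℝ → ℝ} (hf : ContDiffOn ℝ ∞ f U) (hpos : ∀ q ∈ U, 0 < f q) :
    HasFDerivAt (fun q : R4 => f (q 0, q 1))
      ((f (p 0, p 1) * partialX (lnFun f) (p 0, p 1)) • dx
        + (f (p 0, p 1) * partialY (lnFun f) (p 0, p 1)) • dy) p := by
  have h1 := hs.differentiableAt_of_contDiffOn hp hf
  have h2 := mul_partial_lnFun h1 (hpos _ hp.1)
  have h3 := hasFDerivAt_base h1
  rwa [h2.1, h2.2] at h3

omit hp in
theorem partialY_lnFun (q : ℝ × ℝ) : partialY (lnFun H) q = 2 * a * l₂ a H q := by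
  have := hs.a_ne
  simp only [l₂]
  field_simp

omit hp in
theorem partialX_lnFun (q : ℝ × ℝ) : partialX (lnFun H) q = -(2 * a * n₂ a H q) := by
  have := hs.a_ne
  simp only [n₂]
  field_simp

/-- This and the next lemma are the real and imaginary parts of d(τ + iν) = -2ia η ∧ (τ + iν): η is
the connection form of H²(dx² + dy²), divided by 2a, on the circle of angles 2at. -/
theorem hasExtDerivAt_tau : HasExtDerivAt (tau a H)
    (fun u v => 2 * a * (eta a H p u * nu a H p v - eta a H p v * nu a H p u)) p := by
  have hH := hs.hasFDerivAt_log_mul hp hs.smooth_H hs.pos_H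
  have hc := hasFDerivAt_comp_coord (2 * a) 3 (Real.hasDerivAt_cos (2 * a * p 3))
  have hn := hasFDerivAt_comp_coord (2 * a) 3 (Real.hasDerivAt_sin (2 * a * p 3))
  refine ((HasExtDerivAt.smul (hc.fun_mul hH) (.const dx p)).add
    (.smul (hn.fun_mul hH) (.const dy p))).congr fun u v => ?_
  simp [eta_apply, nu_apply, hs.partialX_lnFun, hs.partialY_lnFun]
  ring

theorem hasExtDerivAt_nu : HasExtDerivAt (nu a H)
    (fun u v => -(2 * a) * (eta a H p u * tau a H p v - eta a H p v * tau a H p u)) p := by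
  have hH := hs.hasFDerivAt_log_mul hp hs.smooth_H hs.pos_H
  have hc := hasFDerivAt_comp_coord (2 * a) 3 (Real.hasDerivAt_cos (2 * a * p 3))
  have hn := hasFDerivAt_comp_coord (2 * a) 3 (Real.hasDerivAt_sin (2 * a * p 3))
  refine ((HasExtDerivAt.smul (hc.fun_mul hH) (.const dy p)).sub
    (.smul (hn.fun_mul hH) (.const dx p))).congr fun u v => ?_
  simp [eta_apply, tau_apply, hs.partialX_lnFun, hs.partialY_lnFun]
  ring

/-- `conjDLog f` is * d ln f in the plane, and d * d is the Laplacian. -/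
theorem hasExtDerivAt_conjDLog {f : ℝ × ℝ → ℝ} (hf : ContDiffOn ℝ ∞ f U)
    (hpos : ∀ q ∈ U, 0 < f q) : HasExtDerivAt (conjDLog f)
      (fun u v => flatLaplacian (lnFun f) (p 0, p 1) * (u 0 * v 1 - v 0 * u 1)) p := by
  have hx := hasFDerivAt_base (hs.differentiableAt_of_contDiffOn hp
    (contDiffOn_partialX hs.isOpen (contDiffOn_lnFun hf hpos)))
  have hy := hasFDerivAt_base (hs.differentiableAt_of_contDiffOn hp
    (contDiffOn_partialY hs.isOpen (contDiffOn_lnFun hf hpos)))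
  refine ((HasExtDerivAt.smul hx (.const dy p)).sub
    (.smul hy (.const dx p))).congr fun u v => ?_
  simp [flatLaplacian]
  ring

omit hs hp in
theorem eta_eq : eta a H = fun q => dt + (1 / (2 * a)) • conjDLog H q := by
  ext q u
  simp [eta, conjDLog, l₂, n₂]
  ring

/-- The only place where the equation for Δ ln H enters. Its H² part will cancel τ ∧ ν = H² dx ∧ dy
in later derivatives. -/
theorem hasExtDerivAt_eta : HasExtDerivAt (eta a H)
    (fun u v => (a * h (p 0, p 1) ^ 2 + 2 * a * H (p 0, p 1) ^ 2) * (u 0 * v 1 - v 0 * u 1)) p := by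
  rw [eta_eq]
  refine ((HasExtDerivAt.const dt p).add (.smul (hasFDerivAt_const (1 / (2 * a)) p)
    (hs.hasExtDerivAt_conjDLog hp hs.smooth_H hs.pos_H))).congr fun u v => ?_
  have := hs.a_ne
  simp [hs.laplacian _ hp.1]
  field_simp
  ring

theorem hasExtDerivAt_θ₁ : HasExtDerivAt (θ₁ a h) (fun u v => h (p 0, p 1) *
    (a * Real.cosh (a * p 2) * (u 2 * v 0 - v 2 * u 0)
      + Real.sinh (a * p 2) * partialY (lnFun h) (p 0, p 1) * (u 1 * v 0 - v 1 * u 0))) p := by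
  have hh := hs.hasFDerivAt_log_mul hp hs.smooth_h hs.pos_h
  have hsh := hasFDerivAt_comp_coord a 2 (Real.hasDerivAt_sinh (a * p 2))
  refine (HasExtDerivAt.smul (hsh.fun_mul hh) (.const dx p)).congr fun u v => ?_
  simp
  ring

theorem hasExtDerivAt_θ₂ : HasExtDerivAt (θ₂ a h) (fun u v => h (p 0, p 1) *
    (a * Real.cosh (a * p 2) * (u 2 * v 1 - v 2 * u 1)
      + Real.sinh (a * p 2) * partialX (lnFun h) (p 0, p 1) * (u 0 * v 1 - v 0 * u 1))) p := by
  have hh := hs.hasFDerivAt_log_mul hp hs.smooth_h hs.pos_h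
  have hsh := hasFDerivAt_comp_coord a 2 (Real.hasDerivAt_sinh (a * p 2))
  refine (HasExtDerivAt.smul (hsh.fun_mul hh) (.const dy p)).congr fun u v => ?_
  simp
  ring

theorem hasExtDerivAt_θ₄ : HasExtDerivAt (θ₄ a H)
    (fun u v => -(2 * a) * (eta a H p u * nu a H p v - eta a H p v * nu a H p u)) p := by
  rw [θ₄_eq]
  refine ((HasExtDerivAt.const dz p).sub (hs.hasExtDerivAt_tau hp)).congr fun u v => ?_
  ring

end IsSolution

/-! ### The connection forms -/

/-- The diagonal connection forms in the complex coframe `θ₁ + i θ₂`, `θ₄ + i θ₃`. -/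
def horizontalForm (a : ℝ) (h H : ℝ × ℝ → ℝ) : OneForm := fun p =>
  (2 * a) • Real.cosh (a * p 2) •
    (Real.cosh (a * p 2) • eta a H p - Real.sinh (a * p 2) • nu a H p) + conjDLog h p
def verticalForm (a : ℝ) (H : ℝ × ℝ → ℝ) : OneForm := fun p =>
  (2 * a) • (Real.cosh (2 * a * p 2) • eta a H p - Real.sinh (2 * a * p 2) • nu a H p)

/-- The real and imaginary part of the off-diagonal connection form. -/
def mixedFormRe (a : ℝ) (h : ℝ × ℝ → ℝ) : OneForm := fun p =>
  (Real.cosh (a * p 2) * h (p 0, p 1)) • a • dx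
def mixedFormIm (a : ℝ) (h : ℝ × ℝ → ℝ) : OneForm := fun p =>
  (Real.cosh (a * p 2) * h (p 0, p 1)) • a • dy

theorem horizontalForm_apply (a : ℝ) (h H : ℝ × ℝ → ℝ) (p u : R4) : horizontalForm a h H p u
    = 2 * a * Real.cosh (a * p 2) *
      (Real.cosh (a * p 2) * eta a H p u - Real.sinh (a * p 2) * nu a H p u)
      + conjDLog h p u := by
  simp [horizontalForm]
  ring

theorem verticalForm_apply (a : ℝ) (H : ℝ × ℝ → ℝ) (p u : R4) : verticalForm a H p u
    = 2 * a * ((1 + 2 * Real.sinh (a * p 2) ^ 2) * eta a H p u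
      - 2 * Real.sinh (a * p 2) * Real.cosh (a * p 2) * nu a H p u) := by
  simp [verticalForm, sinh_double, cosh_double]

theorem mixedFormRe_apply (a : ℝ) (h : ℝ × ℝ → ℝ) (p u : R4) :
    mixedFormRe a h p u = a * Real.cosh (a * p 2) * h (p 0, p 1) * u 0 := by
  simp [mixedFormRe]
  ring

theorem mixedFormIm_apply (a : ℝ) (h : ℝ × ℝ → ℝ) (p u : R4) :
    mixedFormIm a h p u = a * Real.cosh (a * p 2) * h (p 0, p 1) * u 1 := by
  simp [mixedFormIm]
  ring

/-! ### Exterior derivatives of θ₃ and of the connection forms -/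

namespace IsSolution

variable {a : ℝ} {U : Set (ℝ × ℝ)} {h H : ℝ × ℝ → ℝ} (hs : IsSolution a U h H)
  {p : R4} (hp : p ∈ totalSpace U)
include hs hp

/-- Substitute dz = θ₄ + τ. The τ ∧ η terms cancel against dν, and the term in τ ∧ ν cancels the H²
part of dη; sin² + cos² = 1 is what turns τ ∧ ν into H² dx ∧ dy. -/
theorem hasExtDerivAt_θ₃ : HasExtDerivAt (θ₃ a H)
    (fun u v => θ₄ a H p u * verticalForm a H p v - θ₄ a H p v * verticalForm a H p u
      + 2 * a * Real.sinh (a * p 2) * Real.cosh (a * p 2) * h (p 0, p 1) ^ 2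
        * (u 0 * v 1 - v 0 * u 1)) p := by
  have hsh := hasFDerivAt_comp_coord (2 * a) 2 (Real.hasDerivAt_sinh (2 * a * p 2))
  have hch := hasFDerivAt_comp_coord (2 * a) 2 (Real.hasDerivAt_cosh (2 * a * p 2))
  rw [θ₃_eq]
  refine ((HasExtDerivAt.smul hsh (hs.hasExtDerivAt_eta hp)).sub
    (.smul hch (hs.hasExtDerivAt_nu hp))).congr fun u v => ?_
  have htr := Real.sin_sq_add_cos_sq (2 * a * p 3)
  simp [θ₄_apply, verticalForm_apply, sinh_double, cosh_double]
  simp only [tau_apply, nu_apply]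
  linear_combination (-4 * a * Real.sinh (a * p 2) * Real.cosh (a * p 2) * H (p 0, p 1) ^ 2
        * (u 0 * v 1 - v 0 * u 1)) * htr

theorem hasExtDerivAt_verticalForm : HasExtDerivAt (verticalForm a H)
    (fun u v => 2 * a * (2 * a * (θ₄ a H p u * θ₃ a H p v - θ₄ a H p v * θ₃ a H p u)
      + a * (1 + 2 * Real.sinh (a * p 2) ^ 2) * h (p 0, p 1) ^ 2 * (u 0 * v 1 - v 0 * u 1))) p := by
  have hsh := hasFDerivAt_comp_coord (2 * a) 2 (Real.hasDerivAt_sinh (2 * a * p 2))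
  have hch := hasFDerivAt_comp_coord (2 * a) 2 (Real.hasDerivAt_cosh (2 * a * p 2))
  refine (HasExtDerivAt.smul (hasFDerivAt_const (2 * a) p)
    ((HasExtDerivAt.smul hch (hs.hasExtDerivAt_eta hp)).sub
    (.smul hsh (hs.hasExtDerivAt_nu hp)))).congr fun u v => ?_
  have htr := Real.sin_sq_add_cos_sq (2 * a * p 3)
  simp [θ₄_apply, θ₃_apply, sinh_double, cosh_double, hs.a_ne]
  simp only [tau_apply, nu_apply]
  linear_combination (-2 * a * (1 + 2 * Real.sinh (a * p 2) ^ 2) * H (p 0, p 1) ^ 2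
        * (u 0 * v 1 - v 0 * u 1)) * htr

theorem hasExtDerivAt_horizontalForm : HasExtDerivAt (horizontalForm a h H)
    (fun u v => 2 * a ^ 2 * (θ₄ a H p u * θ₃ a H p v - θ₄ a H p v * θ₃ a H p u)
      + (2 * a ^ 2 * H (p 0, p 1) ^ 2
        + 2 * a ^ 2 * Real.cosh (a * p 2) ^ 2 * h (p 0, p 1) ^ 2
        + flatLaplacian (lnFun h) (p 0, p 1)) * (u 0 * v 1 - v 0 * u 1)) p := by
  have hsh := hasFDerivAt_comp_coord a 2 (Real.hasDerivAt_sinh (a * p 2))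
  have hch := hasFDerivAt_comp_coord a 2 (Real.hasDerivAt_cosh (a * p 2))
  refine ((HasExtDerivAt.smul (hasFDerivAt_const (2 * a) p) (.smul hch
    ((HasExtDerivAt.smul hch (hs.hasExtDerivAt_eta hp)).sub
    (.smul hsh (hs.hasExtDerivAt_nu hp))))).add
    (hs.hasExtDerivAt_conjDLog hp hs.smooth_h hs.pos_h)).congr fun u v => ?_
  have htr := Real.sin_sq_add_cos_sq (2 * a * p 3)
  have hcs := Real.cosh_sq (a * p 2)
  simp [θ₄_apply, θ₃_apply]
  simp only [tau_apply, nu_apply]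
  linear_combination (-2 * a ^ 2 * H (p 0, p 1) *
      (u 2 * (Real.cos (2 * a * p 3) * v 1 - Real.sin (2 * a * p 3) * v 0)
        - v 2 * (Real.cos (2 * a * p 3) * u 1 - Real.sin (2 * a * p 3) * u 0))
      + 4 * a ^ 2 * H (p 0, p 1) ^ 2 * (u 0 * v 1 - v 0 * u 1)) * hcs
    - 2 * a ^ 2 * (1 + 2 * Real.sinh (a * p 2) ^ 2) * H (p 0, p 1) ^ 2
      * (u 0 * v 1 - v 0 * u 1) * htr

theorem hasExtDerivAt_mixedFormRe : HasExtDerivAt (mixedFormRe a h)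
    (fun u v => a * h (p 0, p 1) * (a * Real.sinh (a * p 2) * (u 2 * v 0 - v 2 * u 0)
      + Real.cosh (a * p 2) * partialY (lnFun h) (p 0, p 1) * (u 1 * v 0 - v 1 * u 0))) p := by
  have hh := hs.hasFDerivAt_log_mul hp hs.smooth_h hs.pos_h
  have hsh := hasFDerivAt_comp_coord a 2 (Real.hasDerivAt_cosh (a * p 2))
  refine (HasExtDerivAt.smul (hsh.fun_mul hh) (.const (a • dx) p)).congr fun u v => ?_
  simp
  ring

theorem hasExtDerivAt_mixedFormIm : HasExtDerivAt (mixedFormIm a h)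
    (fun u v => a * h (p 0, p 1) * (a * Real.sinh (a * p 2) * (u 2 * v 1 - v 2 * u 1)
      + Real.cosh (a * p 2) * partialX (lnFun h) (p 0, p 1) * (u 0 * v 1 - v 0 * u 1))) p := by
  have hh := hs.hasFDerivAt_log_mul hp hs.smooth_h hs.pos_h
  have hsh := hasFDerivAt_comp_coord a 2 (Real.hasDerivAt_cosh (a * p 2))
  refine (HasExtDerivAt.smul (hsh.fun_mul hh) (.const (a • dy) p)).congr fun u v => ?_
  simp
  ring

end IsSolution

/-- The skew-Hermitian matrix with rows `(i a, c + i d)` and `(-c + i d, i b)`, acting on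
four-space with the complex coordinates `x₀ + i x₁` and `x₂ + i x₃`. -/
def unitaryEnd (a b c d : ℝ) : R4 →L[ℝ] R4 :=
  LinearMap.toContinuousLinearMap
    { toFun := fun x => ![-a * x 1 + c * x 2 - d * x 3, a * x 0 + d * x 2 + c * x 3,
        -b * x 3 - c * x 0 - d * x 1, b * x 2 + d * x 0 - c * x 1]
      map_add' := fun x y => by
        ext i
        fin_cases i <;> simp <;> ring
      map_smul' := fun r x => by
        ext i
        fin_cases i <;> simp <;> ring }

theorem unitaryEnd_apply (a b c d : ℝ) (x : R4) :
    unitaryEnd a b c d x = ![-a * x 1 + c * x 2 - d * x 3, a * x 0 + d * x 2 + c * x 3,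
      -b * x 3 - c * x 0 - d * x 1, b * x 2 + d * x 0 - c * x 1] := rfl

theorem unitaryEnd_eq (a b c d : ℝ) : unitaryEnd a b c d = a • unitaryEnd 1 0 0 0
    + b • unitaryEnd 0 1 0 0 + c • unitaryEnd 0 0 1 0 + d • unitaryEnd 0 0 0 1 := by
  ext x i
  fin_cases i <;> simp [unitaryEnd_apply] <;> ring

/-- The Lie bracket of u(2), from which A ∧ A is read off in components. -/
theorem unitaryEnd_commutator (a b c d a' b' c' d' : ℝ) (x : R4) :
    unitaryEnd a b c d (unitaryEnd a' b' c' d' x) - unitaryEnd a' b' c' d' (unitaryEnd a b c d x)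
      = unitaryEnd (2 * (c * d' - c' * d)) (-2 * (c * d' - c' * d))
        (-((a - b) * d' - (a' - b') * d)) ((a - b) * c' - (a' - b') * c) x := by
  ext i
  fin_cases i <;> simp [unitaryEnd_apply] <;> ring

/-- The connection form of the coframe. -/
def connectionForm (a : ℝ) (h H : ℝ × ℝ → ℝ) : R4 → R4 →L[ℝ] R4 →L[ℝ] R4 := fun p =>
  (horizontalForm a h H p).smulRight (unitaryEnd 1 0 0 0)
    + (verticalForm a H p).smulRight (unitaryEnd 0 1 0 0)
    + (mixedFormRe a h p).smulRight (unitaryEnd 0 0 1 0)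
    + (mixedFormIm a h p).smulRight (unitaryEnd 0 0 0 1)

theorem connectionForm_apply (a : ℝ) (h H : ℝ × ℝ → ℝ) (p u : R4) :
    connectionForm a h H p u = unitaryEnd (horizontalForm a h H p u) (verticalForm a H p u)
      (mixedFormRe a h p u) (mixedFormIm a h p u) := by
  rw [unitaryEnd_eq]
  simp [connectionForm]

/-- The coefficient of the curvature in the horizontal plane. -/
def horizontalCurvature (a : ℝ) (h H : ℝ × ℝ → ℝ) (p : R4) : ℝ :=
  (2 * a ^ 2 * H (p 0, p 1) ^ 2 + 4 * a ^ 2 * Real.cosh (a * p 2) ^ 2 * h (p 0, p 1) ^ 2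
    + flatLaplacian (lnFun h) (p 0, p 1)) / (Real.sinh (a * p 2) ^ 2 * h (p 0, p 1) ^ 2)

/-- A curvature operator of complex hyperbolic type in which the coefficient of `(x⁰ ∧ x¹)²` is
replaced by `K`. -/
def modelCurvature (a K : ℝ) (x y : R4) : R4 →L[ℝ] R4 :=
  unitaryEnd (2 * a ^ 2 * (x 2 * y 3 - y 2 * x 3) + K * (x 0 * y 1 - y 0 * x 1))
    (4 * a ^ 2 * (x 2 * y 3 - y 2 * x 3) + 2 * a ^ 2 * (x 0 * y 1 - y 0 * x 1))
    (a ^ 2 * (x 2 * y 0 + x 3 * y 1 - y 2 * x 0 - y 3 * x 1))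
    (a ^ 2 * (x 2 * y 1 - x 3 * y 0 - y 2 * x 1 + y 3 * x 0))

/-! ### Connection and curvature of the coframe -/

namespace IsSolution

variable {a : ℝ} {U : Set (ℝ × ℝ)} {h H : ℝ × ℝ → ℝ} (hs : IsSolution a U h H)
include hs

theorem isConnectionForm :
    IsConnectionForm (totalSpace U) (coframe a h H) (connectionForm a h H) where
  isOpen := isOpen_totalSpace hs.isOpen
  smooth := hs.contDiffOn_coframe
  invertible _ hp := hs.isInvertible_coframe hp
  differentiable p hp :=
    ((((hasFDerivAt_smulRight (hs.hasExtDerivAt_horizontalForm hp).1 _).add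
      (hasFDerivAt_smulRight (hs.hasExtDerivAt_verticalForm hp).1 _)).add
      (hasFDerivAt_smulRight (hs.hasExtDerivAt_mixedFormRe hp).1 _)).add
      (hasFDerivAt_smulRight (hs.hasExtDerivAt_mixedFormIm hp).1 _)).differentiableAt
  skew p _ u v w := by
    simp only [connectionForm_apply, dotProduct_four, unitaryEnd_apply]
    simp
    ring
  torsion p hp u v := by
    have h1 := hs.hasExtDerivAt_θ₁ hp
    have h2 := hs.hasExtDerivAt_θ₂ hp
    have h3 := hs.hasExtDerivAt_θ₃ hp
    have h4 := hs.hasExtDerivAt_θ₄ hp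
    have hd : HasFDerivAt (coframe a h H) _ p :=
      (((hasFDerivAt_smulRight h1.1 _).add (hasFDerivAt_smulRight h2.1 _)).add
      (hasFDerivAt_smulRight h4.1 _)).add (hasFDerivAt_smulRight h3.1 _)
    have e1 := h1.2 u v
    have e2 := h2.2 u v
    have e3 := h3.2 u v
    have e4 := h4.2 u v
    have hcs := Real.cosh_sq (a * p 2)
    have hd' : fderiv ℝ (coframe a h H) p u v - fderiv ℝ (coframe a h H) p v u
        = ![fderiv ℝ (θ₁ a h) p u v - fderiv ℝ (θ₁ a h) p v u,
          fderiv ℝ (θ₂ a h) p u v - fderiv ℝ (θ₂ a h) p v u,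
          fderiv ℝ (θ₄ a H) p u v - fderiv ℝ (θ₄ a H) p v u,
          fderiv ℝ (θ₃ a H) p u v - fderiv ℝ (θ₃ a H) p v u] := by
      rw [hd.fderiv]
      simp only [add_apply, smulRightL_flip_comp_apply]
      ext i
      fin_cases i <;> simp
    rw [hd']
    simp only [connectionForm_apply, unitaryEnd_apply, coframe_apply]
    ext i
    fin_cases i <;> simp
    · simp only [θ₂_apply, θ₄_apply, θ₃_apply, horizontalForm_apply, mixedFormRe_apply,
        mixedFormIm_apply, tau_apply, nu_apply, conjDLog_apply]
      linear_combination e1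
    · simp only [θ₁_apply, θ₄_apply, θ₃_apply, horizontalForm_apply, mixedFormRe_apply,
        mixedFormIm_apply, tau_apply, nu_apply, conjDLog_apply]
      linear_combination e2
    · simp only [θ₁_apply, θ₂_apply, θ₃_apply, verticalForm_apply, mixedFormRe_apply,
        mixedFormIm_apply]
      linear_combination e4 - 8 * a * Real.sinh (a * p 2) ^ 2
        * (eta a H p u * nu a H p v - eta a H p v * nu a H p u) * hcs
    · simp only [θ₁_apply, θ₂_apply, mixedFormRe_apply, mixedFormIm_apply]
      linear_combination e3

/-- dA + A ∧ A, with dA from the derivatives of the four connection forms and A ∧ A from the bracket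
of u(2). -/
theorem curvature_eq {p : R4} (hp : p ∈ totalSpace U) (u v w : R4) :
    coframe a h H p (curvature (coframeMetric (coframe a h H)) p u v w)
      = modelCurvature a (horizontalCurvature a h H p) (coframe a h H p u) (coframe a h H p v)
        (coframe a h H p w) := by
  have h1 := hs.hasExtDerivAt_horizontalForm hp
  have h2 := hs.hasExtDerivAt_verticalForm hp
  have h3 := hs.hasExtDerivAt_mixedFormRe hp
  have h4 := hs.hasExtDerivAt_mixedFormIm hp
  have hd : HasFDerivAt (connectionForm a h H) _ p :=
    (((hasFDerivAt_smulRight h1.1 _).add (hasFDerivAt_smulRight h2.1 _)).add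
    (hasFDerivAt_smulRight h3.1 _)).add (hasFDerivAt_smulRight h4.1 _)
  have hext : fderiv ℝ (connectionForm a h H) p u v - fderiv ℝ (connectionForm a h H) p v u
      = unitaryEnd (fderiv ℝ (horizontalForm a h H) p u v - fderiv ℝ (horizontalForm a h H) p v u)
        (fderiv ℝ (verticalForm a H) p u v - fderiv ℝ (verticalForm a H) p v u)
        (fderiv ℝ (mixedFormRe a h) p u v - fderiv ℝ (mixedFormRe a h) p v u)
        (fderiv ℝ (mixedFormIm a h) p u v - fderiv ℝ (mixedFormIm a h) p v u) := by
    rw [hd.fderiv, unitaryEnd_eq (_ - _)]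
    ext x i
    simp only [add_apply, sub_apply, smul_apply, Pi.add_apply, Pi.sub_apply, Pi.smul_apply,
      smulRightL_flip_comp_apply, smul_eq_mul]
    ring
  have hadd : ∀ a b c d a' b' c' d' : ℝ, ∀ x, unitaryEnd a b c d x + unitaryEnd a' b' c' d' x
      = unitaryEnd (a + a') (b + b') (c + c') (d + d') x := by
    intro a b c d a' b' c' d' x
    ext i
    fin_cases i <;> simp [unitaryEnd_apply] <;> ring
  have hs0 := hs.sinh_ne hp
  have hh0 := hs.h_ne hp
  have hcs := Real.cosh_sq (a * p 2)
  rw [hs.isConnectionForm.curvature_eq hp, hext, add_sub_assoc, connectionForm_apply,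
    connectionForm_apply, unitaryEnd_commutator, hadd, h1.2, h2.2, h3.2, h4.2, modelCurvature]
  congr 2
  -- The term 4a² cosh² h² in K is half from the derivative of the horizontal form and half from the
  -- bracket of the off-diagonal forms; the denominator appears because θ₁ ∧ θ₂ = sinh² h² dx ∧ dy.
  · simp only [coframe_apply, mixedFormRe_apply, mixedFormIm_apply, horizontalCurvature]
    simp [θ₁_apply, θ₂_apply]
    field_simp
    ring
  · simp only [coframe_apply, mixedFormRe_apply, mixedFormIm_apply]
    simp [θ₁_apply, θ₂_apply]
    linear_combination (-2 * a ^ 2 * h (p 0, p 1) ^ 2 * (u 0 * v 1 - v 0 * u 1)) * hcs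
  · simp only [coframe_apply, mixedFormIm_apply, horizontalForm_apply, verticalForm_apply]
    simp [θ₁_apply, θ₂_apply, θ₃_apply, θ₄_apply]
    simp only [tau_apply, nu_apply, conjDLog_apply]
    linear_combination (-2 * a ^ 2 * Real.cosh (a * p 2) * h (p 0, p 1)
        * (eta a H p u * v 1 - eta a H p v * u 1)
      + 2 * a ^ 2 * Real.sinh (a * p 2) * h (p 0, p 1) * H (p 0, p 1) * Real.sin (2 * a * p 3)
        * (u 0 * v 1 - v 0 * u 1)) * hcs
  · simp only [coframe_apply, mixedFormRe_apply, horizontalForm_apply, verticalForm_apply]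
    simp [θ₁_apply, θ₂_apply, θ₃_apply, θ₄_apply]
    simp only [tau_apply, nu_apply, conjDLog_apply]
    linear_combination (2 * a ^ 2 * Real.cosh (a * p 2) * h (p 0, p 1)
        * (eta a H p u * v 0 - eta a H p v * u 0)
      - 2 * a ^ 2 * Real.sinh (a * p 2) * h (p 0, p 1) * H (p 0, p 1) * Real.cos (2 * a * p 3)
        * (u 0 * v 1 - v 0 * u 1)) * hcs

end IsSolution

/-! ### The Hermitian structures -/

theorem modelCurvature_trace (a K : ℝ) (x y : R4) :
    ∑ i, modelCurvature a K (Pi.single i 1) x y i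
      = -(K + 2 * a ^ 2) * (x 0 * y 0 + x 1 * y 1) - 6 * a ^ 2 * (x 2 * y 2 + x 3 * y 3) := by
  simp [Fin.sum_univ_four, modelCurvature, unitaryEnd_apply]
  ring

/-- Only the squared lengths of the two planar components enter, which is the QCH property. For K =
4a² the value is -4a²|x|⁴, as in complex hyperbolic space. -/
theorem modelCurvature_holomorphic (a K : ℝ) (x : R4) :
    modelCurvature a K x (stdComplex 1 x) (stdComplex 1 x) ⬝ᵥ x
      = -(K * (x 0 ^ 2 + x 1 ^ 2) ^ 2 + 8 * a ^ 2 * (x 0 ^ 2 + x 1 ^ 2) * (x 2 ^ 2 + x 3 ^ 2)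
        + 4 * a ^ 2 * (x 2 ^ 2 + x 3 ^ 2) ^ 2) := by
  rw [dotProduct_four]
  simp [modelCurvature, unitaryEnd_apply, stdComplex_apply]
  ring

theorem mem_verticalPlane {p u : R4} : u ∈ verticalPlane p ↔ u 0 = 0 ∧ u 1 = 0 := by
  rw [verticalPlane, Submodule.mem_span_pair]
  constructor
  · rintro ⟨r, s, rfl⟩
    simp
  · rintro ⟨h0, h1⟩
    refine ⟨u 2, u 3, ?_⟩
    ext i
    fin_cases i <;> simp [h0, h1]

theorem isSmoothPlaneField_verticalPlane {M : Set R4} (hM : IsOpen M) :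
    IsSmoothPlaneField M verticalPlane := by
  refine ⟨fun p _ => ?_, fun p hp => ⟨M, hM, hp, subset_rfl, fun _ => Pi.single 2 1,
    fun _ => Pi.single 3 1, contDiffOn_const, contDiffOn_const, fun q _ => rfl⟩⟩
  have h1 : LinearIndependent ℝ ![(Pi.single 2 1 : R4), (Pi.single 3 1 : R4)] := by
    rw [LinearIndependent.pair_iff]
    intro s t hst
    have h2 := congrFun hst 2
    have h3 := congrFun hst 3
    simp at h2 h3
    exact ⟨h2, h3⟩
  have h2 := finrank_span_eq_card h1
  rwa [Matrix.range_cons, Matrix.range_cons, Matrix.range_empty, Set.union_empty,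
    Set.singleton_union] at h2

theorem one_sq_eq : (1 : ℝ) ^ 2 = 1 := one_pow 2

theorem neg_one_sq_eq : (-1 : ℝ) ^ 2 = 1 := by norm_num

namespace IsSolution

variable {a : ℝ} {U : Set (ℝ × ℝ)} {h H : ℝ × ℝ → ℝ} (hs : IsSolution a U h H)
include hs

/-- The off-diagonal entries are multiples of θ₁ and θ₂ themselves. The integrability of J and its
Lee form both rest on this. -/
theorem connectionForm_eq {p : R4} (hp : p ∈ totalSpace U) (u : R4) :
    connectionForm a h H p u = unitaryEnd (horizontalForm a h H p u) (verticalForm a H p u)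
      (a * (Real.cosh (a * p 2) / Real.sinh (a * p 2)) * coframe a h H p u 0)
      (a * (Real.cosh (a * p 2) / Real.sinh (a * p 2)) * coframe a h H p u 1) := by
  have := hs.sinh_ne hp
  rw [connectionForm_apply, mixedFormRe_apply, mixedFormIm_apply, coframe_apply]
  simp only [Matrix.cons_val_zero, Matrix.cons_val_one, θ₁_apply, θ₂_apply]
  congr 1 <;> field_simp

/-- The connection form is u(2)-valued and so commutes with `stdComplex 1`; every term of the
obstruction cancels. -/
theorem isHermitian_one : IsHermitian (totalSpace U) (coframeMetric (coframe a h H))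
    (coframeEnd (coframe a h H) (stdComplex 1)) := by
  refine hs.isConnectionForm.isHermitian (stdComplex_sq one_sq_eq)
    (stdComplex_dotProduct one_sq_eq) fun p hp u v u' v' hu hv => ?_
  simp only [connectionForm_apply]
  ext i
  fin_cases i <;> simp [unitaryEnd_apply, stdComplex_apply] <;> ring

/-- The diagonal part of A commutes with `stdComplex (-1)`; the off-diagonal part cancels because
its coefficients θ₁, θ₂ rotate when the argument is turned by J. -/
theorem isHermitian_neg_one : IsHermitian (totalSpace U) (coframeMetric (coframe a h H))
    (coframeEnd (coframe a h H) (stdComplex (-1))) := by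
  refine hs.isConnectionForm.isHermitian (stdComplex_sq neg_one_sq_eq)
    (stdComplex_dotProduct neg_one_sq_eq) fun p hp u v u' v' hu hv => ?_
  simp only [hs.connectionForm_eq hp, hu, hv]
  ext i
  fin_cases i <;> simp [unitaryEnd_apply, stdComplex_apply] <;> ring

theorem isKahler_one : IsKahler (totalSpace U) (coframeMetric (coframe a h H))
    (coframeEnd (coframe a h H) (stdComplex 1)) where
  hermitian := hs.isHermitian_one
  closed p hp := threeForm_ext fun u v w => by
    rw [hs.isConnectionForm.extDeriv_kahlerForm (stdComplex_sq one_sq_eq)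
      (stdComplex_dotProduct one_sq_eq) hp]
    simp only [dotProduct_four]
    simp [connectionForm_apply, unitaryEnd_apply, stdComplex_apply]
    ring

/-- Only the off-diagonal part of A contributes, and it gives dΩ = 4a coth az θ₄ ∧ θ₁ ∧ θ₂. -/
theorem isLeeForm_neg_one : IsLeeForm (totalSpace U) (coframeMetric (coframe a h H))
    (coframeEnd (coframe a h H) (stdComplex (-1))) (fun p => -alpha a p • θ₄ a H p) := by
  refine fun p hp => threeForm_ext fun u v w => ?_
  have hk := fun u v => hs.isConnectionForm.kahlerForm_apply (stdComplex_sq neg_one_sq_eq)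
    (stdComplex_dotProduct neg_one_sq_eq) hp u v
  have h4 : ∀ u, θ₄ a H p u = coframe a h H p u 2 := fun u => by simp [coframe_apply]
  rw [hs.isConnectionForm.extDeriv_kahlerForm (stdComplex_sq neg_one_sq_eq)
    (stdComplex_dotProduct neg_one_sq_eq) hp]
  simp only [ContinuousAlternatingMap.smul_apply, covWedge_apply, hk, smul_apply, smul_eq_mul, h4,
    hs.connectionForm_eq hp, alpha, dotProduct_four]
  simp [unitaryEnd_apply, stdComplex_apply]
  ring

theorem kahlerForm_eq {ε : ℝ} (hε : ε ^ 2 = 1) {p : R4} (hp : p ∈ totalSpace U) :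
    kahlerForm (coframeMetric (coframe a h H)) (coframeEnd (coframe a h H) (stdComplex ε)) p
      = Real.sinh (a * p 2) ^ 2 • volSigma h p + ε • wedge (θ₄ a H p) (θ₃ a H p) := by
  refine twoForm_ext fun u v => ?_
  rw [hs.isConnectionForm.kahlerForm_apply (stdComplex_sq hε) (stdComplex_dotProduct hε) hp]
  simp only [ContinuousAlternatingMap.smul_apply, ContinuousAlternatingMap.add_apply, volSigma,
    wedge_apply, smul_eq_mul, coframe_apply, stdComplex_apply, dotProduct_four]
  simp [θ₁_apply, θ₂_apply]
  ring

/-- Ricci is -(K + 2a²) on the (θ₁, θ₂)-plane and -6a² on the (θ₄, θ₃)-plane, and J rotates each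
plane. -/
theorem hasInvariantRicci : HasInvariantRicci (totalSpace U) (coframeMetric (coframe a h H))
    (coframeEnd (coframe a h H) (stdComplex (-1))) := by
  intro p hp
  have hric : ∀ u v, ricci (coframeMetric (coframe a h H)) p u v
      = -(horizontalCurvature a h H p + 2 * a ^ 2)
          * (coframe a h H p u 0 * coframe a h H p v 0 + coframe a h H p u 1 * coframe a h H p v 1)
        - 6 * a ^ 2 * (coframe a h H p u 2 * coframe a h H p v 2
          + coframe a h H p u 3 * coframe a h H p v 3) := by
    intro u v
    let L : R4 →ₗ[ℝ] R4 :=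
      { toFun := fun w => modelCurvature a (horizontalCurvature a h H p) w (coframe a h H p u)
          (coframe a h H p v)
        map_add' := fun x y => by
          ext i
          fin_cases i <;> simp [modelCurvature, unitaryEnd_apply] <;> ring
        map_smul' := fun r x => by
          ext i
          fin_cases i <;> simp [modelCurvature, unitaryEnd_apply] <;> ring }
    rw [hs.isConnectionForm.ricci_eq hp u v L fun w => hs.curvature_eq hp w u v]
    exact modelCurvature_trace _ _ _ _
  intro u v
  rw [hric, hric]
  simp only [coframeEnd_apply (hs.isInvertible_coframe hp), stdComplex_apply]
  simp
  ring

theorem isQCHKahler : IsQCHKahler (totalSpace U) (coframeMetric (coframe a h H))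
    (coframeEnd (coframe a h H) (stdComplex 1)) verticalPlane where
  kahler := hs.isKahler_one
  smooth := isSmoothPlaneField_verticalPlane (isOpen_totalSpace hs.isOpen)
  invariant p hp u hu := by
    have hJ := coframeEnd_apply (J₀ := stdComplex 1) (hs.isInvertible_coframe hp) u
    have h0 := congrFun hJ 0
    have h1 := congrFun hJ 1
    rw [mem_verticalPlane] at hu ⊢
    simp [coframe_apply, stdComplex_apply, θ₁_apply, θ₂_apply, hu.1, hu.2, hs.sinh_ne hp,
      hs.h_ne hp] at h0 h1
    exact ⟨h0, h1⟩
  holomorphicCurvature := by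
    -- For a unit vector the vertical part has squared length r² and the horizontal part 1 - r².
    refine ⟨fun p r => -(horizontalCurvature a h H p * (1 - r ^ 2) ^ 2
      + 8 * a ^ 2 * (1 - r ^ 2) * r ^ 2 + 4 * a ^ 2 * (r ^ 2) ^ 2), ?_⟩
    intro p hp X XD hX hXD hperp
    have hJ := coframeEnd_apply (J₀ := stdComplex 1) (hs.isInvertible_coframe hp) X
    rw [mem_verticalPlane] at hXD
    -- In the frame ∂_z and ∂_t are nonzero multiples of the last two basis vectors, so X and its
    -- projection have the same last two components.
    have h2 := hperp (Pi.single 2 1) (mem_verticalPlane.2 (by simp))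
    have h3 := hperp (Pi.single 3 1) (mem_verticalPlane.2 (by simp))
    have e2 : coframe a h H p (Pi.single 2 1) = ![0, 0, 1, 0] := by
      simp [coframe_apply, θ₁_apply, θ₂_apply, θ₃_apply, θ₄_apply, tau_apply, nu_apply, eta_apply]
    have e3 : coframe a h H p (Pi.single 3 1)
        = ![0, 0, 0, 2 * Real.sinh (a * p 2) * Real.cosh (a * p 2)] := by
      simp [coframe_apply, θ₁_apply, θ₂_apply, θ₃_apply, θ₄_apply, tau_apply, nu_apply, eta_apply]
    have hXD0 : coframe a h H p XD 0 = 0 := by simp [coframe_apply, θ₁_apply, hXD.1]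
    have hXD1 : coframe a h H p XD 1 = 0 := by simp [coframe_apply, θ₂_apply, hXD.2]
    rw [coframeMetric_apply, e2, dotProduct_four, map_sub] at h2
    rw [coframeMetric_apply, e3, dotProduct_four, map_sub] at h3
    simp [sub_eq_zero] at h2
    simp [sub_eq_zero, hs.sinh_ne hp, (Real.cosh_pos _).ne'] at h3
    have hr : coframeMetric (coframe a h H) p XD XD
        = coframe a h H p X 2 ^ 2 + coframe a h H p X 3 ^ 2 := by
      rw [coframeMetric_apply, dotProduct_four, hXD0, hXD1, h2, h3]
      ring
    have hA : coframe a h H p X 0 ^ 2 + coframe a h H p X 1 ^ 2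
        = 1 - (coframe a h H p X 2 ^ 2 + coframe a h H p X 3 ^ 2) := by
      rw [← hX, coframeMetric_apply, dotProduct_four]
      ring
    rw [coframeMetric_apply, hs.curvature_eq hp, hJ, modelCurvature_holomorphic, hr]
    beta_reduce
    rw [Real.sq_sqrt (by positivity), hA]

/-- In dimension four the wedge product with a nondegenerate two-form is injective on covectors. -/
theorem eq_zero_of_covWedge {p : R4} (hp : p ∈ totalSpace U) (β : R4 →L[ℝ] ℝ)
    (hβ : covWedge β (kahlerForm (coframeMetric (coframe a h H))
      (coframeEnd (coframe a h H) (stdComplex (-1))) p) = 0) : β = 0 := by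
  have hi := hs.isInvertible_coframe hp
  obtain ⟨E, hE, hE'⟩ : ∃ E : Fin 4 → R4, (∀ i, coframe a h H p (E i) = Pi.single i 1) ∧
      ∀ i, (coframe a h H p).inverse (Pi.single i 1) = E i :=
    ⟨fun i => (coframe a h H p).inverse (Pi.single i 1), fun i => hi.self_apply_inverse _,
      fun _ => rfl⟩
  have hk : ∀ i j, kahlerForm (coframeMetric (coframe a h H))
      (coframeEnd (coframe a h H) (stdComplex (-1))) p ![E i, E j]
        = stdComplex (-1) (Pi.single i 1) ⬝ᵥ Pi.single j 1 := fun i j => by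
    rw [hs.isConnectionForm.kahlerForm_apply (stdComplex_sq neg_one_sq_eq)
      (stdComplex_dotProduct neg_one_sq_eq) hp, hE, hE]
  have hk' := fun i j k => (covWedge_apply β _ (E i) (E j) (E k)).symm.trans
    (congrArg (fun ψ : R4 [⋀^Fin 3]→L[ℝ] ℝ => ψ ![E i, E j, E k]) hβ)
  simp only [hk, dotProduct_four, stdComplex_apply] at hk'
  -- Ω pairs E 0 with E 1 and E 2 with E 3 only, so one vector of a pair together with the
  -- complementary pair isolates ±β on that vector.
  have h0 := hk' 0 2 3
  have h1 := hk' 1 2 3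
  have h2 := hk' 2 0 1
  have h3 := hk' 3 0 1
  simp at h0 h1 h2 h3
  have hL : (β ∘L (coframe a h H p).inverse).toLinearMap = 0 := by
    refine (Pi.basisFun ℝ (Fin 4)).ext fun i => ?_
    fin_cases i <;> simpa [hE']
  ext1 u
  have := congrArg (fun L : R4 →ₗ[ℝ] ℝ => L (coframe a h H p u)) hL
  simpa [hi.inverse_apply_self] using this

theorem not_isLocallyConformallyKahler (hU : U.Nonempty) :
    ¬ IsLocallyConformallyKahler (totalSpace U) (coframeMetric (coframe a h H))
      (coframeEnd (coframe a h H) (stdComplex (-1))) := by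
  obtain ⟨q, hq⟩ := hU
  -- At t = 0 one has ν(∂_y) = H; the value z = -1 is an arbitrary negative number.
  let p : R4 := ![q.1, q.2, -1, 0]
  have hp : p ∈ totalSpace U := ⟨by simpa [p] using hq, by simp [p]⟩
  have hs0 := hs.sinh_ne hp
  -- The value of k is irrelevant: dz vanishes on the test vectors ∂_t and ∂_y, so dθ on them is -α
  -- dθ₄(∂_t, ∂_y) = 2aαH, which is not zero.
  obtain ⟨k, hα⟩ : ∃ k : ℝ, HasFDerivAt (fun q => -alpha a q)
      (k • (ContinuousLinearMap.proj 2 : R4 →L[ℝ] ℝ)) p := by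
    have hd : DifferentiableAt ℝ (fun x => -(-2 * a * (Real.cosh x / Real.sinh x))) (a * p 2) :=
      ((Real.differentiable_cosh.differentiableAt.div Real.differentiable_sinh.differentiableAt
        hs0).const_mul _).neg
    exact ⟨_, hasFDerivAt_comp_coord a 2 hd.hasDerivAt⟩
  have hθ := HasExtDerivAt.smul hα (hs.hasExtDerivAt_θ₄ hp)
  refine KahlerSurface.not_isLocallyConformallyKahler (isOpen_totalSpace hs.isOpen)
    hs.isConnectionForm.isRiemannian.smooth (hs.isConnectionForm.contDiffOn_coframeEnd _)
    hs.isLeeForm_neg_one (fun q hq => hs.eq_zero_of_covWedge hq) hp hθ.1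
    (u := Pi.single 3 1) (v := Pi.single 1 1) ?_
  rw [← sub_ne_zero, hθ.2]
  have hc := (Real.cosh_pos (a * p 2)).ne'
  have hp3 : p 3 = 0 := rfl
  simp [eta_apply, nu_apply, hp3, alpha, hs.a_ne, hs.H_ne hp, hs0, hc]

end IsSolution

end KahlerSurface

end

/-! ### The theorem -/

theorem theorem3 (a : ℝ) (ha : a ≠ 0) (U : Set (ℝ × ℝ)) (hU : IsOpen U) (hU_ne : U.Nonempty)
    (h H : ℝ × ℝ → ℝ)
    (hh : ContDiffOn ℝ ∞ h U) (hh_pos : ∀ q ∈ U, 0 < h q)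
    (hH : ContDiffOn ℝ ∞ H U) (hH_pos : ∀ q ∈ U, 0 < H q)
    (hH_eq : ∀ q ∈ U,
      flatLaplacian (lnFun H) q = 2 * a ^ 2 * h q ^ 2 + 4 * a ^ 2 * H q ^ 2) :
    ∃ Jbar J : EndField,
      IsQCHKahler (totalSpace U) (metric a h H) Jbar verticalPlane ∧
      (∀ p ∈ totalSpace U, kahlerForm (metric a h H) Jbar p =
        Real.sinh (a * p 2) ^ 2 • volSigma h p + wedge (θ₄ a H p) (θ₃ a H p)) ∧
      IsOppositeHermitian (totalSpace U) (metric a h H) Jbar J ∧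
      (∀ p ∈ totalSpace U, kahlerForm (metric a h H) J p =
        Real.sinh (a * p 2) ^ 2 • volSigma h p + wedge (θ₃ a H p) (θ₄ a H p)) ∧
      HasInvariantRicci (totalSpace U) (metric a h H) J ∧
      ¬ IsLocallyConformallyKahler (totalSpace U) (metric a h H) J ∧
      IsLeeForm (totalSpace U) (metric a h H) J (fun p => -alpha a p • θ₄ a H p) := by
  have hs : IsSolution a U h H := ⟨ha, hU, hh, hh_pos, hH, hH_pos, hH_eq⟩
  rw [metric_eq]
  refine ⟨coframeEnd (coframe a h H) (stdComplex 1), coframeEnd (coframe a h H) (stdComplex (-1)),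
    hs.isQCHKahler, fun p hp => ?_,
    ⟨hs.isHermitian_neg_one, fun p hp => exists_orientation hs.isConnectionForm hp⟩,
    fun p hp => ?_, hs.hasInvariantRicci, hs.not_isLocallyConformallyKahler hU_ne,
    hs.isLeeForm_neg_one⟩
  · rw [hs.kahlerForm_eq one_sq_eq hp, one_smul]
  · rw [hs.kahlerForm_eq neg_one_sq_eq hp]
    congr 1
    refine twoForm_ext fun u v => ?_
    rw [ContinuousAlternatingMap.smul_apply, wedge_apply, wedge_apply, smul_eq_mul]
    ring
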